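/- **Setting.** Let $X$ be covariates, $Z\in\{0,1\}$ an instrument (cohort assignment), $D(0),D(1)\in\{0,1\}$ potential treatments and $Y(0),Y(1)$ integrable real potential outcomes; $D=D(Z)$ and $Y=Y(D)$ are observed. The instrument is a stratified randomized trial with non-compliance and known propensity $\pi_0(X)=\Pr(Z=1\mid X)\in(0,1)$: $Z$ is independent of $(D(0),D(1),Y(0),Y(1))$ given $X$, $D(1)\ge D(0)$ almost surely, and $\Pr(D(1)>D(0)\mid X)>0$ almost surely. Let $$\tau_0(X)=\mathbb E[Y(1)-Y(0)\mid D(1)>D(0),X],\qquad \tilde Z=Z-\pi_0(X),\qquad \beta_0(X)=\mathbb E[D\tilde Z\mid X].$$ Let $\hat\alpha,\hat\beta$ be fixed measurable functions (estimates trained on a separate sample) with $\hat\beta(X)\neq0$ almost surely, and put $\hat\tau=\hat\alpha/\hat\beta$. For $g=(\tau,\beta)$ let $$\hat Y(g)=\tau(X)+\frac{(Y-\tau(X)D)\tilde Z}{\beta(X)},\qquad \hat g=(\hat\tau,\hat\beta),\quad g_0=(\tau_0,\beta_0),$$ $$\mathrm{Error}(\hat g)^2=4\,\mathbb E\!\left[(\tau_0(X)-\hat\tau(X))^2\,\frac{(\beta_0(X)-\hat\beta(X))^2}{\hat\beta(X)^2}\right]\in[0,\infty].$$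 Assume $|\hat Y(\hat g)|\le U$ almost surely. **Q-aggregation.** Let $f_1,\dots,f_M$ ($M\ge1$) be fixed measurable functions with $|f_j(X)|\le U$ almost surely, $f_\theta=\sum_j\theta_jf_j$ for $\theta$ in the probability simplex $\Theta\subset\mathbb R^M$, and $\|f-\tau_0\|^2=\mathbb E[(f(X)-\tau_0(X))^2]$. Given an i.i.d. sample of size $n\ge1$ of $(X,Z,D,Y)$ with empirical mean $P_n$, a prior $\pi$ ($\pi_j>0$, $\sum_j\pi_j=1$) and $\beta\in\mathbb R$, let $\hat\theta$ be any minimizer over $\theta\in\Theta$ of $$P_n\Big[(1-\nu)(\hat Y(\hat g)-f_\theta(X))^2+\nu\sum_{j}\theta_j(\hat Y(\hat g)-f_j(X))^2\Big]+\frac{\beta}{n}\sum_j\theta_j\log(1/\pi_j),\qquad \nu=\tfrac12 .$$ **Claim.** For every $U$ there is a constant $C>0$ depending only on $U$ such that in every such setting: 1. (Mixed bias) Almost surely $\mathbb E[\hat Y(\hat g)\mid X]-\tau_0(X)=(\tau_0(X)-\hat\tau(X))\,\dfrac{\beta_0(X)-\hat\beta(X)}{\hat\beta(X)}$; and if $\hat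 Y(g_0)$ is integrable, $\mathbb E[\hat Y(\hat g)-\hat Y(g_0)\mid X]$ equals the same expression almost surely. 2. (Uniform prior) If $\pi_j=1/M$ for all $j$ (in which case $\beta$ does not affect $\hat\theta$), then for every $\delta\in(0,1)$, with probability at least $1-\delta$, $$\|f_{\hat\theta}-\tau_0\|^2\le\min_j\|f_j-\tau_0\|^2+C\left(\frac{\log M+\log(1/\delta)}{n}+\mathrm{Error}(\hat g)^2\right).$$ 3. (General prior) For every prior $\pi$ and every $\beta\ge\max\{112U^2,56U^3\}$, for every $\delta\in(0,1)$, with probability at least $1-\delta$, $$\|f_{\hat\theta}-\tau_0\|^2\le\min_j\left(\|f_j-\tau_0\|^2+\frac{\beta}{n}\log(1/\pi_j)\right)+C\left(\frac{\log(1/\delta)}{n}+\mathrm{Error}(\hat g)^2\right).$$ -/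

import Mathlib

open MeasureTheory ProbabilityTheory
open scoped ENNReal

noncomputable section

/-- The numerical value (`0` or `1`) of a binary variable. -/
def ind (b : Bool) : ℝ := if b then 1 else 0

/-- The random variables of a randomized trial with non-compliance: covariates `X`, a binary
instrument (cohort assignment) `Z`, the potential treatments `Dpot z` under assignment `z`, and the
potential outcomes `Ypot d` under treatment `d`.  Outcomes depend on the assignment only through
the treatment (exclusion). -/
structure IVTrial (Ω 𝒳 : Type*) where
  X : Ω → 𝒳
  Z : Ω → Bool
  Dpot : Bool → Ω → Bool
  Ypot : Bool → Ω → ℝ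

/-- An observation `(x, z, d, y)`. -/
abbrev Obs (𝒳 : Type*) : Type _ := 𝒳 × Bool × Bool × ℝ

namespace IVTrial

variable {Ω 𝒳 : Type*} (T : IVTrial Ω 𝒳)

/-- The observed treatment `D = D(Z)`. -/
def D (ω : Ω) : Bool := T.Dpot (T.Z ω) ω

/-- The observed outcome `Y = Y(D)`. -/
def Y (ω : Ω) : ℝ := T.Ypot (T.D ω) ω

/-- The observed data point. -/
def obs (ω : Ω) : Obs 𝒳 := (T.X ω, T.Z ω, T.D ω, T.Y ω)

/-- The compliers: the event `D(1) > D(0)`. -/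
def compliers : Set Ω := {ω | T.Dpot false ω < T.Dpot true ω}

/-- All potential treatments and outcomes. -/
def potentials (ω : Ω) : Bool × Bool × ℝ × ℝ :=
  (T.Dpot false ω, T.Dpot true ω, T.Ypot false ω, T.Ypot true ω)

/-- The σ-algebra generated by the covariates. -/
abbrev sigmaX [MeasurableSpace 𝒳] : MeasurableSpace Ω := MeasurableSpace.comap T.X inferInstance

/-- `T` is, under `μ`, a stratified randomized trial with non-compliance whose assignment
policy is `π₀(X) = Pr(Z = 1 ∣ X)`. -/
structure IsStratified [MeasurableSpace Ω] [StandardBorelSpace Ω] [MeasurableSpace 𝒳]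
    (μ : Measure Ω) [IsProbabilityMeasure μ] (π₀ : 𝒳 → ℝ) : Prop where
  measurable_X : Measurable T.X
  measurable_Z : Measurable T.Z
  measurable_Dpot : ∀ z, Measurable (T.Dpot z)
  measurable_Ypot : ∀ d, Measurable (T.Ypot d)
  integrable_Ypot : ∀ d, Integrable (T.Ypot d) μ
  measurable_propensity : Measurable π₀
  /-- the assignment policy -/
  propensity : (fun ω => π₀ (T.X ω)) =ᵐ[μ] μ[fun ω => ind (T.Z ω) | T.sigmaX]
  /-- overlap -/
  overlap : ∀ᵐ ω ∂μ, 0 < π₀ (T.X ω) ∧ π₀ (T.X ω) < 1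
  /-- the assignment is randomized within strata of `X` -/
  randomized : CondIndepFun T.sigmaX measurable_X.comap_le T.Z T.potentials μ
  /-- monotonicity: there are no defiers -/
  monotone : ∀ᵐ ω ∂μ, T.Dpot false ω ≤ T.Dpot true ω
  /-- relevance: there are compliers in every stratum -/
  relevant : ∀ᵐ ω ∂μ, 0 < (μ[T.compliers.indicator (fun _ => (1 : ℝ)) | T.sigmaX]) ω

/-- `τ₀(X) = E[Y(1) - Y(0) ∣ D(1) > D(0), X]`: the conditional expectation given `X` under the
measure `μ` conditioned on the compliers. -/
structure IsCLATE [MeasurableSpace Ω] [MeasurableSpace 𝒳] (μ : Measure Ω) (τ₀ : 𝒳 → ℝ) :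
    Prop where
  measurable : Measurable τ₀
  version : (fun ω => τ₀ (T.X ω)) =ᵐ[cond μ T.compliers]
    condExp T.sigmaX (cond μ T.compliers) (fun ω => T.Ypot true ω - T.Ypot false ω)

/-- `β₀(X) = E[D (Z - π₀(X)) ∣ X]`. -/
structure IsCompliance [MeasurableSpace Ω] [MeasurableSpace 𝒳] (μ : Measure Ω)
    (π₀ β₀ : 𝒳 → ℝ) : Prop where
  measurable : Measurable β₀
  version : (fun ω => β₀ (T.X ω)) =ᵐ[μ]
    μ[fun ω => ind (T.D ω) * (ind (T.Z ω) - π₀ (T.X ω)) | T.sigmaX]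

/-- `‖f - τ₀‖² = E[(f(X) - τ₀(X))²]`, as an extended nonnegative real. -/
def sqDist [MeasurableSpace Ω] (μ : Measure Ω) (f τ₀ : 𝒳 → ℝ) : ℝ≥0∞ :=
  ∫⁻ ω, ENNReal.ofReal ((f (T.X ω) - τ₀ (T.X ω)) ^ 2) ∂μ

/-- `Error(ĝ)² = 4 E[(τ₀(X) - τ̂(X))² (β₀(X) - β̂(X))² / β̂(X)²]`, as an extended nonnegative
real. -/
def errorSq [MeasurableSpace Ω] (μ : Measure Ω) (τ₀ β₀ τh βh : 𝒳 → ℝ) : ℝ≥0∞ :=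
  4 * ∫⁻ ω, ENNReal.ofReal ((τ₀ (T.X ω) - τh (T.X ω)) ^ 2 *
    ((β₀ (T.X ω) - βh (T.X ω)) ^ 2 / βh (T.X ω) ^ 2)) ∂μ

/-- The law of an i.i.d. sample of `n` observations. -/
def sampleLaw [MeasurableSpace Ω] [MeasurableSpace 𝒳] (μ : Measure Ω) (n : ℕ) :
    Measure (Fin n → Obs 𝒳) :=
  Measure.pi (fun _ => μ.map T.obs)

end IVTrial

section QAggregation

variable {𝒳 : Type*} {M n : ℕ}

/-- The doubly robust pseudo-outcome `τ(x) + (y - τ(x) d) (z - π₀(x)) / β(x)`. -/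
def pseudoOutcome (π₀ τ β : 𝒳 → ℝ) : Obs 𝒳 → ℝ := fun (x, z, d, y) =>
  τ x + (y - τ x * ind d) * (ind z - π₀ x) / β x

/-- The ensemble `f_θ = ∑ θ_j f_j`. -/
def ensemble (f : Fin M → 𝒳 → ℝ) (θ : Fin M → ℝ) (x : 𝒳) : ℝ := ∑ j, θ j * f j x

/-- The loss `(1 - ν) (Ŷ - f_θ(X))² + ν ∑ θ_j (Ŷ - f_j(X))²` for the square loss with label `Ŷ`. -/
def qLoss (ν : ℝ) (label : Obs 𝒳 → ℝ) (f : Fin M → 𝒳 → ℝ) (θ : Fin M → ℝ) (o : Obs 𝒳) : ℝ :=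
  (1 - ν) * (label o - ensemble f θ o.1) ^ 2 + ν * ∑ j, θ j * (label o - f j o.1) ^ 2

/-- The Q-aggregation objective on the sample `s`, with prior `p` and temperature `b`. -/
def qObjective (ν b : ℝ) (p : Fin M → ℝ) (label : Obs 𝒳 → ℝ) (f : Fin M → 𝒳 → ℝ)
    (s : Fin n → Obs 𝒳) (θ : Fin M → ℝ) : ℝ :=
  (1 / n : ℝ) * ∑ i, qLoss ν label f θ (s i) + b / n * ∑ j, θ j * Real.log (1 / p j)

/-- `θ` are Q-aggregation weights: a minimizer of the objective over the probability simplex. -/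
def IsQAggregate (ν b : ℝ) (p : Fin M → ℝ) (label : Obs 𝒳 → ℝ) (f : Fin M → 𝒳 → ℝ)
    (s : Fin n → Obs 𝒳) (θ : Fin M → ℝ) : Prop :=
  θ ∈ stdSimplex ℝ (Fin M) ∧ IsMinOn (qObjective ν b p label f s) (stdSimplex ℝ (Fin M)) θ

end QAggregation

end

/-! Two independent facts are combined: the pseudo-outcome has a small conditional bias, and
Q-aggregation satisfies a fast-rate oracle inequality for any bounded label.

Bias. Given `X`, the centred instrument `Z - π₀(X)` is uncorrelated with every integrable function
of the potential variables (`condExp_ind_sub_mul_comp`). Treatment and outcome are affine in `Z`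
with coefficients depending on those variables, and monotonicity concentrates the slopes on the
compliers. Hence `E[DZ̃ ∣ X] = π₀(1 - π₀) Pr(C ∣ X)`, with `C` the event of compliance, and `E[YZ̃ ∣
X] = τ₀β₀`. The pseudo-outcome therefore has conditional mean `τ + (τ₀ - τ)β₀/β`, which differs from
`τ₀` by a product of two nuisance errors.

Oracle inequality. Fix a competitor `j`. The empirical loss difference between a minimizer and `j`,
plus the curvature gained by minimality, is exactly a quadratic form `∑ θ_k θ_l ξ_kl`
(`qLoss_sub_add_eq`). Its coefficients do not depend on `θ`, so it suffices to control each pair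
`(k, l)` by a Chernoff bound, giving that pair the failure probability `p_k p_l δ`; averaging with
weights `θ_k θ_l` then covers all minimizers at once, without any supremum over the simplex. The
quadratic term in each exponential moment is dominated by part of the spread supplied by curvature
and by the linear part of the loss, and the cost `log(1/p_k) + log(1/p_l)` is absorbed by the
entropy penalty once `b ≥ 112U²`. The leftover spread gives a bonus `(1/25)‖f_θ - f_j‖²` in the
excess risk (`integral_excess_le_sum_sum`).

Transfer. Replacing the label by `τ₀` costs a cross term `2(f_θ - f_j)·bias`, which the bonus
absorbs at the price of `25 E[bias²] = (25/4) Error²` (`integral_sq_sub_target_le`). -/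

noncomputable section

/-! ### Convexity and the quadratic form of the Q-aggregation loss. -/

section QAggregation

variable {𝒳 : Type*} {M n : ℕ}

theorem ensemble_segment (f : Fin M → 𝒳 → ℝ) (θ θ' : Fin M → ℝ) (t : ℝ) (x : 𝒳) :
    ensemble f ((1 - t) • θ + t • θ') x = (1 - t) * ensemble f θ x + t * ensemble f θ' x := by
  simp only [ensemble, Finset.mul_sum, ← Finset.sum_add_distrib]
  refine Finset.sum_congr rfl fun j _ => ?_
  simp only [Pi.add_apply, Pi.smul_apply, smul_eq_mul]
  ring

theorem ensemble_single (f : Fin M → 𝒳 → ℝ) (j : Fin M) (x : 𝒳) :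
    ensemble f (Pi.single j 1) x = f j x := by
  simp [ensemble, Pi.single_apply]

/-- The second summand of the loss is linear in the weights, so only the squared residual of the
ensemble contributes curvature, with factor `1 - ν`. -/
theorem qLoss_segment (ν : ℝ) (label : Obs 𝒳 → ℝ) (f : Fin M → 𝒳 → ℝ) (θ θ' : Fin M → ℝ) (t : ℝ)
    (o : Obs 𝒳) :
    qLoss ν label f ((1 - t) • θ + t • θ') o =
      (1 - t) * qLoss ν label f θ o + t * qLoss ν label f θ' o -
        (1 - ν) * (t * (1 - t)) * (ensemble f θ' o.1 - ensemble f θ o.1) ^ 2 := by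
  have h : ∑ j, ((1 - t) • θ + t • θ') j * (label o - f j o.1) ^ 2 =
      (1 - t) * ∑ j, θ j * (label o - f j o.1) ^ 2 +
        t * ∑ j, θ' j * (label o - f j o.1) ^ 2 := by
    simp only [Finset.mul_sum, ← Finset.sum_add_distrib]
    refine Finset.sum_congr rfl fun j _ => ?_
    simp only [Pi.add_apply, Pi.smul_apply, smul_eq_mul]
    ring
  simp only [qLoss, h, ensemble_segment]
  ring

/-- The objective of Q-aggregation is a quadratic function with an explicit curvature. -/
theorem qObjective_segment (ν b : ℝ) (p : Fin M → ℝ) (label : Obs 𝒳 → ℝ) (f : Fin M → 𝒳 → ℝ)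
    (s : Fin n → Obs 𝒳) (θ θ' : Fin M → ℝ) (t : ℝ) :
    qObjective ν b p label f s ((1 - t) • θ + t • θ') =
      (1 - t) * qObjective ν b p label f s θ + t * qObjective ν b p label f s θ' -
        (1 - ν) * (t * (1 - t)) *
          ((1 / n : ℝ) * ∑ i, (ensemble f θ' (s i).1 - ensemble f θ (s i).1) ^ 2) := by
  have h : ∑ j, ((1 - t) • θ + t • θ') j * Real.log (1 / p j) =
      (1 - t) * ∑ j, θ j * Real.log (1 / p j) + t * ∑ j, θ' j * Real.log (1 / p j) := by
    simp only [Finset.mul_sum, ← Finset.sum_add_distrib]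
    refine Finset.sum_congr rfl fun j _ => ?_
    simp only [Pi.add_apply, Pi.smul_apply, smul_eq_mul]
    ring
  simp only [qObjective, h, qLoss_segment, Finset.sum_sub_distrib, Finset.sum_add_distrib,
    ← Finset.mul_sum]
  ring

/-- A minimizer beats every other point of the simplex by the curvature of the objective. -/
theorem IsQAggregate.add_curvature_le {ν b : ℝ} {p : Fin M → ℝ} {label : Obs 𝒳 → ℝ}
    {f : Fin M → 𝒳 → ℝ} {s : Fin n → Obs 𝒳} {θ : Fin M → ℝ}
    (h : IsQAggregate ν b p label f s θ) {θ' : Fin M → ℝ} (hθ' : θ' ∈ stdSimplex ℝ (Fin M)) :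
    qObjective ν b p label f s θ + (1 - ν) *
        ((1 / n : ℝ) * ∑ i, (ensemble f θ' (s i).1 - ensemble f θ (s i).1) ^ 2) ≤
      qObjective ν b p label f s θ' := by
  set D := (1 - ν) * ((1 / n : ℝ) * ∑ i, (ensemble f θ' (s i).1 - ensemble f θ (s i).1) ^ 2)
    with hD
  -- Minimality against the point at parameter `t` of the segment, divided by `t`; the limit `t → 0`
  -- then recovers the full curvature.
  have key : ∀ t ∈ Set.Ioo (0 : ℝ) 1,
      (1 - t) * D ≤ qObjective ν b p label f s θ' - qObjective ν b p label f s θ := by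
    rintro t ⟨h0, h1⟩
    have hmem : (1 - t) • θ + t • θ' ∈ stdSimplex ℝ (Fin M) :=
      convex_stdSimplex ℝ (Fin M) h.1 hθ' (by linarith) h0.le (by ring)
    have h2 := h.2 hmem
    simp only [Set.mem_ofPred_eq, qObjective_segment] at h2
    refine le_of_mul_le_mul_left ?_ h0
    rw [hD]
    linarith
  have hlim : Filter.Tendsto (fun t : ℝ => (1 - t) * D) (nhdsWithin 0 (Set.Ioi 0))
      (nhds ((1 - 0) * D)) :=
    ((continuous_const.sub continuous_id).mul continuous_const).tendsto 0 |>.mono_left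
      nhdsWithin_le_nhds
  have := le_of_tendsto hlim (Filter.eventually_of_mem (Ioo_mem_nhdsGT one_pos) key)
  linarith

/-- The excess of the product of two residuals over the squared residual of a reference value. -/
def crossExcess (y a u v : ℝ) : ℝ := (y - u) * (y - v) - (y - a) ^ 2

/-- The sum of the squared deviations of two values from a reference value. -/
def sqSpread (a u v : ℝ) : ℝ := (u - a) ^ 2 + (v - a) ^ 2

theorem sum_sum_mul_add {θ : Fin M → ℝ} (hθ : ∑ j, θ j = 1) (g : Fin M → ℝ) :
    ∑ k, ∑ l, θ k * θ l * (g k + g l) = 2 * ∑ k, θ k * g k := by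
  have h1 : ∀ k, ∑ l, θ k * θ l * (g k + g l) = θ k * g k + θ k * ∑ l, θ l * g l := by
    intro k
    have : ∀ l, θ k * θ l * (g k + g l) = θ k * g k * θ l + θ k * (θ l * g l) := fun l => by ring
    simp only [this, Finset.sum_add_distrib, ← Finset.mul_sum, hθ, mul_one]
  simp only [h1, Finset.sum_add_distrib, ← Finset.sum_mul, hθ]
  ring

theorem sum_sum_const {θ : Fin M → ℝ} (hθ : ∑ j, θ j = 1) (c : ℝ) :
    ∑ k, ∑ l, θ k * θ l * c = c := by
  simp only [← Finset.sum_mul, ← Finset.mul_sum, hθ, mul_one, one_mul]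

theorem sub_ensemble {θ : Fin M → ℝ} (hθ : ∑ j, θ j = 1) (f : Fin M → 𝒳 → ℝ) (x : 𝒳) (y : ℝ) :
    y - ensemble f θ x = ∑ k, θ k * (y - f k x) := by
  simp only [ensemble, mul_sub, Finset.sum_sub_distrib, ← Finset.sum_mul, hθ, one_mul]

/-- The product of residuals factorizes over `k` and `l`, so its average is the square of the
averaged residual. Thus a quadratic function of the weights becomes an average over pairs of
candidates. -/
theorem sum_sum_crossExcess {θ : Fin M → ℝ} (hθ : ∑ j, θ j = 1) (f : Fin M → 𝒳 → ℝ) (x : 𝒳)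
    (y a : ℝ) :
    ∑ k, ∑ l, θ k * θ l * crossExcess y a (f k x) (f l x) =
      (y - ensemble f θ x) ^ 2 - (y - a) ^ 2 := by
  have h : ∀ k l, θ k * θ l * crossExcess y a (f k x) (f l x) =
      (θ k * (y - f k x)) * (θ l * (y - f l x)) - θ k * θ l * (y - a) ^ 2 := by
    intro k l
    rw [crossExcess]
    ring
  simp only [h, Finset.sum_sub_distrib, sum_sum_const hθ]
  rw [sub_ensemble hθ, sq (∑ k, θ k * (y - f k x)), Finset.sum_mul_sum]

theorem sum_sum_sqSpread {θ : Fin M → ℝ} (hθ : ∑ j, θ j = 1) (f : Fin M → 𝒳 → ℝ) (x : 𝒳)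
    (a : ℝ) :
    ∑ k, ∑ l, θ k * θ l * sqSpread a (f k x) (f l x) = 2 * ∑ k, θ k * (f k x - a) ^ 2 :=
  sum_sum_mul_add hθ fun k => (f k x - a) ^ 2

/-- The loss of Q-aggregation as a quadratic form in the weights. -/
theorem qLoss_sub_add_eq {θ : Fin M → ℝ} (hθ : ∑ j, θ j = 1) (label : Obs 𝒳 → ℝ)
    (f : Fin M → 𝒳 → ℝ) (j : Fin M) (o : Obs 𝒳) :
    qLoss (1 / 2) label f θ o - qLoss (1 / 2) label f (Pi.single j 1) o +
        1 / 2 * (f j o.1 - ensemble f θ o.1) ^ 2 =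
      ∑ k, ∑ l, θ k * θ l * (crossExcess (label o) (f j o.1) (f k o.1) (f l o.1) +
        1 / 4 * sqSpread (f j o.1) (f k o.1) (f l o.1)) := by
  have h4 : ∀ k l, θ k * θ l * (crossExcess (label o) (f j o.1) (f k o.1) (f l o.1) +
        1 / 4 * sqSpread (f j o.1) (f k o.1) (f l o.1)) =
      θ k * θ l * crossExcess (label o) (f j o.1) (f k o.1) (f l o.1) +
        1 / 4 * (θ k * θ l * sqSpread (f j o.1) (f k o.1) (f l o.1)) := fun k l => by ring
  simp only [h4, Finset.sum_add_distrib, ← Finset.mul_sum]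
  rw [sum_sum_crossExcess hθ, sum_sum_sqSpread hθ]
  -- Mean squared deviations about `f j` and about the label share the same second moment, so they
  -- differ only by terms in the ensemble mean and constants.
  have h1 : ∑ k, θ k * (f k o.1 - f j o.1) ^ 2 =
      ∑ k, θ k * (label o - f k o.1) ^ 2 + 2 * (label o - f j o.1) * ensemble f θ o.1
        - (label o ^ 2 - f j o.1 ^ 2) := by
    have : ∀ k, θ k * (f k o.1 - f j o.1) ^ 2 = θ k * (label o - f k o.1) ^ 2 +
        2 * (label o - f j o.1) * (θ k * f k o.1) - θ k * (label o ^ 2 - f j o.1 ^ 2) :=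
      fun k => by ring
    simp only [this, Finset.sum_add_distrib, Finset.sum_sub_distrib, ← Finset.mul_sum,
      ← Finset.sum_mul, hθ, one_mul, ensemble]
  have h2 : ∑ k, (Pi.single j (1 : ℝ) : Fin M → ℝ) k * (label o - f k o.1) ^ 2 =
      (label o - f j o.1) ^ 2 := by simp [Pi.single_apply]
  simp only [qLoss, h1, h2, ensemble_single]
  ring

/-- Jensen's inequality for the square; it lets the averaged spread pay for the distance of the
ensemble from the competitor. -/
theorem sq_ensemble_sub_le {θ : Fin M → ℝ} (hθ : θ ∈ stdSimplex ℝ (Fin M)) (f : Fin M → 𝒳 → ℝ)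
    (x : 𝒳) (a : ℝ) :
    (ensemble f θ x - a) ^ 2 ≤ ∑ k, θ k * (f k x - a) ^ 2 := by
  have h := (even_two.convexOn_pow (𝕜 := ℝ)).map_sum_le (t := Finset.univ) (w := θ)
    (p := fun k => a - f k x) (fun k _ => hθ.1 k) hθ.2 (fun _ _ => Set.mem_univ _)
  simp only [smul_eq_mul] at h
  rw [← sub_ensemble hθ.2] at h
  simpa only [sub_sq_comm a] using h

theorem abs_ensemble_le {f : Fin M → 𝒳 → ℝ} {θ : Fin M → ℝ} (hθ : θ ∈ stdSimplex ℝ (Fin M))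
    {x : 𝒳} {U : ℝ} (h : ∀ j, |f j x| ≤ U) : |ensemble f θ x| ≤ U := by
  calc |ensemble f θ x| ≤ ∑ j, |θ j * f j x| := Finset.abs_sum_le_sum_abs _ _
    _ ≤ ∑ j, θ j * U := Finset.sum_le_sum fun j _ => by
        rw [abs_mul, abs_of_nonneg (hθ.1 j)]
        exact mul_le_mul_of_nonneg_left (h j) (hθ.1 j)
    _ = U := by rw [← Finset.sum_mul, hθ.2, one_mul]

/-- The deterministic part of the oracle inequality: the empirical excess of the quadratic form is
controlled by the prior. -/
theorem IsQAggregate.sum_crossExcess_le {b : ℝ} {p : Fin M → ℝ} {label : Obs 𝒳 → ℝ}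
    {f : Fin M → 𝒳 → ℝ} {s : Fin n → Obs 𝒳} {θ : Fin M → ℝ} (hn : 1 ≤ n)
    (h : IsQAggregate (1 / 2) b p label f s θ) (j : Fin M) :
    ∑ i, ∑ k, ∑ l, θ k * θ l * (crossExcess (label (s i)) (f j (s i).1) (f k (s i).1) (f l (s i).1)
        + 1 / 4 * sqSpread (f j (s i).1) (f k (s i).1) (f l (s i).1)) +
      b * ∑ k, θ k * Real.log (1 / p k) ≤ b * Real.log (1 / p j) := by
  have hn' : (0 : ℝ) < n := by exact_mod_cast hn
  have h1 := h.add_curvature_le (single_mem_stdSimplex ℝ j)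
  have h2 : ∑ k, (Pi.single j (1 : ℝ) : Fin M → ℝ) k * Real.log (1 / p k) =
    Real.log (1 / p j) := by simp [Pi.single_apply]
  simp only [qObjective, ensemble_single, h2] at h1
  simp only [← qLoss_sub_add_eq h.1.2, Finset.sum_add_distrib, Finset.sum_sub_distrib,
    ← Finset.mul_sum]
  have h3 := mul_le_mul_of_nonneg_left h1 hn'.le
  field_simp at h3
  linarith

end QAggregation

/-! ### Exponential moments and the Chernoff bound for one pair. -/

section Deviation

theorem exp_le_one_add_add_sq {x : ℝ} (hx : |x| ≤ 1 / 7) :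
    Real.exp x ≤ 1 + x + 3 / 4 * x ^ 2 := by
  have h := Real.exp_bound (x := x) (by linarith) (n := 3) (by norm_num)
  simp only [Finset.sum_range_succ, Finset.sum_range_zero, Nat.factorial] at h
  norm_num at h
  have h1 := (abs_le.1 h).2
  have h2 : |x| ^ 3 ≤ x ^ 2 := by
    rw [pow_succ, sq_abs]
    nlinarith [sq_nonneg x]
  linarith [sq_nonneg x]

/-- Scaling by `56U²` brings this range within `1/7`, where the quadratic bound on the exponential
applies. -/
theorem abs_crossExcess_add_le {U y a u v : ℝ} (hy : |y| ≤ U) (ha : |a| ≤ U)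
    (hu : |u| ≤ U) (hv : |v| ≤ U) :
    |crossExcess y a u v + 1 / 4 * sqSpread a u v| ≤ 8 * U ^ 2 := by
  rw [abs_le] at *
  rw [crossExcess, sqSpread]
  have h (x : ℝ) (h : -U ≤ x ∧ x ≤ U) (z : ℝ) (h' : -U ≤ z ∧ z ≤ U) : |x - z| ≤ 2 * U :=
    abs_le.2 ⟨by linarith, by linarith⟩
  have hsq (x : ℝ) (h : -U ≤ x ∧ x ≤ U) (z : ℝ) (h' : -U ≤ z ∧ z ≤ U) :
      (x - z) ^ 2 ≤ 4 * U ^ 2 := by nlinarith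
  have h1 : |(y - u) * (y - v)| ≤ 4 * U ^ 2 := by
    rw [abs_mul]
    nlinarith [h y hy u hu, h y hy v hv, abs_nonneg (y - u), abs_nonneg (y - v)]
  have h1' := abs_le.1 h1
  have h2 := hsq y hy a ha
  have h3 := hsq u hu a ha
  have h4 := hsq v hv a ha
  constructor <;> nlinarith [sq_nonneg (y - a), sq_nonneg (u - a), sq_nonneg (v - a)]

/-- A Bernstein-type condition: the excess vanishes at `u = v = a` and is Lipschitz there, so its
square is controlled by the spread. This is what makes the rate `1/n` rather than `1/√n`. -/
theorem sq_crossExcess_add_le {U y a u v : ℝ} (hy : |y| ≤ U) (ha : |a| ≤ U)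
    (hu : |u| ≤ U) (hv : |v| ≤ U) :
    (crossExcess y a u v + 1 / 4 * sqSpread a u v) ^ 2 ≤ 17 * U ^ 2 * sqSpread a u v := by
  have hmid (w : ℝ) (hw : |w| ≤ U) : (y - (a + w) / 2) ^ 2 ≤ 4 * U ^ 2 := by
    rw [abs_le] at *
    nlinarith
  have hsq (w : ℝ) (hw : |w| ≤ U) : (w - a) ^ 2 ≤ 4 * U ^ 2 := by
    rw [abs_le] at *
    nlinarith
  -- Splitting the product term `(u - a)(v - a)` evenly leaves residuals at midpoints, each bounded
  -- by `2U`.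
  have hG : crossExcess y a u v =
      -((u - a) * (y - (a + v) / 2) + (v - a) * (y - (a + u) / 2)) := by
    rw [crossExcess]
    ring
  have hS : 0 ≤ sqSpread a u v := by rw [sqSpread]; positivity
  have hS8 : sqSpread a u v ≤ 8 * U ^ 2 := by
    rw [sqSpread]
    linarith [hsq u hu, hsq v hv]
  have hG2 : crossExcess y a u v ^ 2 ≤ 8 * U ^ 2 * sqSpread a u v := by
    rw [hG, sqSpread]
    have h1 := mul_le_mul_of_nonneg_left (hmid v hv) (sq_nonneg (u - a))
    have h2 := mul_le_mul_of_nonneg_left (hmid u hu) (sq_nonneg (v - a))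
    nlinarith [sq_nonneg ((u - a) * (y - (a + v) / 2) - (v - a) * (y - (a + u) / 2))]
  -- With `G` the excess and `S` the spread, `(G + S/4)² ≤ 2G² + S²/8 ≤ 16U²S + U²S`.
  nlinarith [sq_nonneg (crossExcess y a u v - 1 / 4 * sqSpread a u v),
    mul_le_mul_of_nonneg_left hS8 hS]

/-- The second-order term of the exponential is at most a multiple of the spread, so it is paid for
by lowering the coefficient of the spread from `1/4` to `1/50`. -/
theorem exp_neg_crossExcess_le {U y a u v : ℝ} (hU : 0 < U) (hy : |y| ≤ U) (ha : |a| ≤ U)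
    (hu : |u| ≤ U) (hv : |v| ≤ U) :
    Real.exp (-((crossExcess y a u v + 1 / 4 * sqSpread a u v) / (56 * U ^ 2))) ≤
      1 - (crossExcess y a u v + 1 / 50 * sqSpread a u v) / (56 * U ^ 2) := by
  have hU2 : 0 < U ^ 2 := by positivity
  have h1 := abs_crossExcess_add_le hy ha hu hv
  have h2 := sq_crossExcess_add_le hy ha hu hv
  have hS : 0 ≤ sqSpread a u v := by rw [sqSpread]; positivity
  generalize crossExcess y a u v = G at *
  generalize sqSpread a u v = S at *
  refine (exp_le_one_add_add_sq ?_).trans ?_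
  · rw [abs_neg, abs_div, abs_of_pos (by positivity : 0 < 56 * U ^ 2), div_le_iff₀ (by positivity)]
    linarith
  · have h3 : (-((G + 1 / 4 * S) / (56 * U ^ 2))) ^ 2 ≤ (17 / 56 * S) / (56 * U ^ 2) := by
      rw [neg_sq, div_pow, div_le_div_iff₀ (by positivity) (by positivity)]
      nlinarith
    have h4 : 0 ≤ S / (56 * U ^ 2) := by positivity
    have e1 : (G + 1 / 4 * S) / (56 * U ^ 2) = G / (56 * U ^ 2) + 1 / 4 * (S / (56 * U ^ 2)) := by
      ring
    have e2 : (G + 1 / 50 * S) / (56 * U ^ 2) = G / (56 * U ^ 2) + 1 / 50 * (S / (56 * U ^ 2)) := by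
      ring
    have e3 : (17 / 56 * S) / (56 * U ^ 2) = 17 / 56 * (S / (56 * U ^ 2)) := by ring
    -- The numerical margin is `(3/4)(17/56) = 51/224 ≤ 1/4 - 1/50`.
    linarith

variable {𝒪 : Type*} [MeasurableSpace 𝒪]

theorem integrable_of_abs_le {P : Measure 𝒪} [IsFiniteMeasure P] {g : 𝒪 → ℝ} (hg : Measurable g)
    (K : ℝ) (h : ∀ᵐ o ∂P, |g o| ≤ K) : Integrable g P :=
  Integrable.of_bound hg.aestronglyMeasurable K h

theorem integrable_crossExcess_add {P : Measure 𝒪} [IsFiniteMeasure P] {U : ℝ}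
    {y a u v : 𝒪 → ℝ} (my : Measurable y) (ma : Measurable a) (mu : Measurable u)
    (mv : Measurable v) (hy : ∀ᵐ o ∂P, |y o| ≤ U) (ha : ∀ᵐ o ∂P, |a o| ≤ U)
    (hu : ∀ᵐ o ∂P, |u o| ≤ U) (hv : ∀ᵐ o ∂P, |v o| ≤ U) :
    Integrable (fun o => crossExcess (y o) (a o) (u o) (v o) +
      1 / 50 * sqSpread (a o) (u o) (v o)) P := by
  refine integrable_of_abs_le (by simp only [crossExcess, sqSpread]; fun_prop) (16 * U ^ 2) ?_
  filter_upwards [hy, ha, hu, hv] with o h1 h2 h3 h4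
  have h5 := abs_le.1 (abs_crossExcess_add_le h1 h2 h3 h4)
  have h6 : sqSpread (a o) (u o) (v o) ≤ 8 * U ^ 2 := by
    rw [abs_le] at *
    rw [sqSpread]
    nlinarith
  have h7 : 0 ≤ sqSpread (a o) (u o) (v o) := by rw [sqSpread]; positivity
  rw [abs_le]
  constructor <;> linarith

/-- The exponential moment that drives the oracle inequality. -/
theorem integral_exp_crossExcess_le {P : Measure 𝒪} [IsProbabilityMeasure P] {U : ℝ} (hU : 0 < U)
    {y a u v : 𝒪 → ℝ} (my : Measurable y) (ma : Measurable a) (mu : Measurable u)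
    (mv : Measurable v) (hy : ∀ᵐ o ∂P, |y o| ≤ U) (ha : ∀ᵐ o ∂P, |a o| ≤ U)
    (hu : ∀ᵐ o ∂P, |u o| ≤ U) (hv : ∀ᵐ o ∂P, |v o| ≤ U) :
    Integrable (fun o => Real.exp ((∫ o', (crossExcess (y o') (a o') (u o') (v o') +
        1 / 50 * sqSpread (a o') (u o') (v o')) ∂P - (crossExcess (y o) (a o) (u o) (v o) +
        1 / 4 * sqSpread (a o) (u o) (v o))) / (56 * U ^ 2))) P ∧
    ∫ o, Real.exp ((∫ o', (crossExcess (y o') (a o') (u o') (v o') +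
        1 / 50 * sqSpread (a o') (u o') (v o')) ∂P - (crossExcess (y o) (a o) (u o) (v o) +
        1 / 4 * sqSpread (a o) (u o) (v o))) / (56 * U ^ 2)) ∂P ≤ 1 := by
  set c := ∫ o', (crossExcess (y o') (a o') (u o') (v o') +
        1 / 50 * sqSpread (a o') (u o') (v o')) ∂P with hc
  set ξ : 𝒪 → ℝ := fun o => crossExcess (y o) (a o) (u o) (v o) +
    1 / 4 * sqSpread (a o) (u o) (v o) with hξ
  have mξ : Measurable ξ := by
    simp only [hξ, crossExcess, sqSpread]
    fun_prop
  have hsplit : ∀ o, Real.exp ((c - ξ o) / (56 * U ^ 2)) =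
      Real.exp (c / (56 * U ^ 2)) * Real.exp (-(ξ o / (56 * U ^ 2))) := fun o => by
    rw [← Real.exp_add, sub_div, sub_eq_add_neg]
  have hU2 : 0 < 56 * U ^ 2 := by positivity
  have hall : ∀ᵐ o ∂P, |y o| ≤ U ∧ |a o| ≤ U ∧ |u o| ≤ U ∧ |v o| ≤ U := by
    filter_upwards [hy, ha, hu, hv] with o h1 h2 h3 h4 using ⟨h1, h2, h3, h4⟩
  have hint : Integrable (fun o => Real.exp (-(ξ o / (56 * U ^ 2)))) P := by
    refine integrable_of_abs_le (by fun_prop) (Real.exp 1) ?_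
    filter_upwards [hall] with o ⟨h1, h2, h3, h4⟩
    rw [abs_of_pos (Real.exp_pos _), Real.exp_le_exp, neg_le, le_div_iff₀ hU2]
    have := (abs_le.1 (abs_crossExcess_add_le h1 h2 h3 h4)).1
    simp only [hξ]
    nlinarith
  have hintL := integrable_crossExcess_add my ma mu mv hy ha hu hv
  change Integrable (fun o => Real.exp ((c - ξ o) / (56 * U ^ 2))) P ∧
    ∫ o, Real.exp ((c - ξ o) / (56 * U ^ 2)) ∂P ≤ 1
  simp only [hsplit]
  refine ⟨hint.const_mul _, ?_⟩
  have hle : ∫ o, Real.exp (-(ξ o / (56 * U ^ 2))) ∂P ≤ 1 - c / (56 * U ^ 2) := by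
    calc _ ≤ ∫ o, (1 - (crossExcess (y o) (a o) (u o) (v o) +
        1 / 50 * sqSpread (a o) (u o) (v o)) / (56 * U ^ 2)) ∂P := by
          refine integral_mono_ae hint ((integrable_const _).sub (hintL.div_const _)) ?_
          filter_upwards [hall] with o ⟨h1, h2, h3, h4⟩
          exact exp_neg_crossExcess_le hU h1 h2 h3 h4
      _ = _ := by
          rw [integral_sub (integrable_const _) (hintL.div_const _), integral_div, ← hc]
          simp
  rw [integral_const_mul]
  -- Here `1 - x ≤ exp(-x)` makes the bound cancel the centring factor exactly.
  calc _ ≤ Real.exp (c / (56 * U ^ 2)) * Real.exp (-(c / (56 * U ^ 2))) := by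
        refine mul_le_mul_of_nonneg_left (hle.trans ?_) (Real.exp_pos _).le
        linarith [Real.add_one_le_exp (-(c / (56 * U ^ 2)))]
    _ = 1 := by rw [← Real.exp_add, add_neg_cancel, Real.exp_zero]

/-- Chernoff bound for a sum of independent copies with exponential moment at most one. -/
theorem pi_measure_lt_sum_le {P : Measure 𝒪} [IsProbabilityMeasure P] {n : ℕ} {W : 𝒪 → ℝ}
    (hint : Integrable (fun o => Real.exp (W o)) P) (hW : ∫ o, Real.exp (W o) ∂P ≤ 1) {q : ℝ}
    (hq : 0 < q) :
    Measure.pi (fun _ : Fin n => P) {s | Real.log (1 / q) < ∑ i, W (s i)} ≤ ENNReal.ofReal q := by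
  have hI : Integrable (fun s : Fin n → 𝒪 => ∏ i, Real.exp (W (s i)))
      (Measure.pi fun _ : Fin n => P) := Integrable.fintype_prod fun _ => hint
  have h1 : ∫ s : Fin n → 𝒪, ∏ i, Real.exp (W (s i)) ∂(Measure.pi fun _ : Fin n => P) ≤ 1 := by
    rw [integral_fintype_prod_eq_prod (fun (_ : Fin n) o => Real.exp (W o))]
    exact Finset.prod_le_one (fun _ _ => integral_nonneg fun _ => (Real.exp_pos _).le)
      fun _ _ => hW
  have h2 := mul_meas_ge_le_integral_of_nonneg
    (Filter.Eventually.of_forall fun s => Finset.prod_nonneg fun i _ => (Real.exp_pos _).le) hI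
    (1 / q)
  have h3 : (Measure.pi fun _ : Fin n => P).real
      {s : Fin n → 𝒪 | 1 / q ≤ ∏ i, Real.exp (W (s i))} ≤ q := by
    have := h2.trans h1
    rwa [one_div_mul_eq_div, div_le_iff₀ hq, one_mul] at this
  calc _ ≤ Measure.pi (fun _ : Fin n => P) {s | 1 / q ≤ ∏ i, Real.exp (W (s i))} := by
        refine measure_mono fun s hs => ?_
        simp only [Set.mem_ofPred_eq] at hs ⊢
        rw [← Real.exp_sum, ← Real.log_le_iff_le_exp (by positivity)]
        exact hs.le
    _ ≤ _ := by
        rw [← ENNReal.ofReal_toReal (measure_ne_top (Measure.pi fun _ : Fin n => P) _)]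
        exact ENNReal.ofReal_le_ofReal h3

end Deviation

/-! ### The oracle inequality for a bounded label. -/

section OracleInequality

variable {𝒳 : Type*} [MeasurableSpace 𝒳] {M n : ℕ}

theorem measurable_ensemble {f : Fin M → 𝒳 → ℝ} (hf : ∀ j, Measurable (f j)) (θ : Fin M → ℝ) :
    Measurable (ensemble f θ) := by
  unfold ensemble
  fun_prop

/-- The average of the expected quadratic forms dominates the excess risk of the ensemble. -/
theorem integral_excess_le_sum_sum {P : Measure (Obs 𝒳)} [IsProbabilityMeasure P] {U : ℝ}
    {label : Obs 𝒳 → ℝ} (hlabel : Measurable label) (hlabelU : ∀ᵐ o ∂P, |label o| ≤ U)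
    {f : Fin M → 𝒳 → ℝ} (hf : ∀ j, Measurable (f j)) (hfU : ∀ j, ∀ᵐ o ∂P, |f j o.1| ≤ U)
    {θ : Fin M → ℝ} (hθ : θ ∈ stdSimplex ℝ (Fin M)) (j : Fin M) :
    ∫ o, ((label o - ensemble f θ o.1) ^ 2 - (label o - f j o.1) ^ 2 +
        1 / 25 * (ensemble f θ o.1 - f j o.1) ^ 2) ∂P ≤
      ∑ k, ∑ l, θ k * θ l * ∫ o, (crossExcess (label o) (f j o.1) (f k o.1) (f l o.1) +
        1 / 50 * sqSpread (f j o.1) (f k o.1) (f l o.1)) ∂P := by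
  have hint : ∀ k l, Integrable (fun o : Obs 𝒳 => θ k * θ l *
      (crossExcess (label o) (f j o.1) (f k o.1) (f l o.1) +
        1 / 50 * sqSpread (f j o.1) (f k o.1) (f l o.1))) P := fun k l =>
    (integrable_crossExcess_add hlabel ((hf j).comp measurable_fst) ((hf k).comp measurable_fst)
      ((hf l).comp measurable_fst) hlabelU (hfU j) (hfU k) (hfU l)).const_mul _
  simp only [← integral_const_mul]
  have e : ∑ k, ∑ l, ∫ o, θ k * θ l * (crossExcess (label o) (f j o.1) (f k o.1) (f l o.1) +
        1 / 50 * sqSpread (f j o.1) (f k o.1) (f l o.1)) ∂P =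
      ∫ o, ∑ k, ∑ l, θ k * θ l * (crossExcess (label o) (f j o.1) (f k o.1) (f l o.1) +
        1 / 50 * sqSpread (f j o.1) (f k o.1) (f l o.1)) ∂P := by
    rw [integral_finsetSum _ fun k _ => integrable_finsetSum _ fun l _ => hint k l]
    exact Finset.sum_congr rfl fun k _ => (integral_finsetSum _ fun l _ => hint k l).symm
  rw [e]
  refine integral_mono_ae ?_ (integrable_finsetSum _ fun k _ =>
    integrable_finsetSum _ fun l _ => hint k l) (Filter.Eventually.of_forall fun o => ?_)
  · have mθ := measurable_ensemble hf θ
    have mj := hf j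
    refine integrable_of_abs_le (by fun_prop) (16 * U ^ 2) ?_
    filter_upwards [hlabelU, ae_all_iff.2 hfU] with o h1 h2
    have h3 := abs_le.1 (abs_ensemble_le hθ h2)
    have h4 := abs_le.1 (h2 j)
    rw [abs_le] at h1
    have e1 : (label o - ensemble f θ o.1) ^ 2 ≤ 4 * U ^ 2 := by nlinarith
    have e2 : (label o - f j o.1) ^ 2 ≤ 4 * U ^ 2 := by nlinarith
    have e3 : (ensemble f θ o.1 - f j o.1) ^ 2 ≤ 4 * U ^ 2 := by nlinarith
    rw [abs_le]
    constructor <;> nlinarith [sq_nonneg (label o - ensemble f θ o.1),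
      sq_nonneg (label o - f j o.1), sq_nonneg (ensemble f θ o.1 - f j o.1)]
  · have h4 : ∀ k l, θ k * θ l * (crossExcess (label o) (f j o.1) (f k o.1) (f l o.1) +
          1 / 50 * sqSpread (f j o.1) (f k o.1) (f l o.1)) =
        θ k * θ l * crossExcess (label o) (f j o.1) (f k o.1) (f l o.1) +
          1 / 50 * (θ k * θ l * sqSpread (f j o.1) (f k o.1) (f l o.1)) := fun k l => by ring
    simp only [h4, Finset.sum_add_distrib, ← Finset.mul_sum]
    rw [sum_sum_crossExcess hθ.2, sum_sum_sqSpread hθ.2]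
    have := sq_ensemble_sub_le hθ f o.1 (f j o.1)
    linarith

/-- Oracle inequality for Q-aggregation with the square loss, in terms of the excess risk with
respect to the label. -/
theorem measure_exists_isQAggregate_le {P : Measure (Obs 𝒳)} [IsProbabilityMeasure P] {U : ℝ}
    (hU : 0 < U) {label : Obs 𝒳 → ℝ} (hlabel : Measurable label)
    (hlabelU : ∀ᵐ o ∂P, |label o| ≤ U) {f : Fin M → 𝒳 → ℝ} (hf : ∀ j, Measurable (f j))
    (hfU : ∀ j, ∀ᵐ o ∂P, |f j o.1| ≤ U) (hn : 1 ≤ n) {δ : ℝ} (hδ : 0 < δ) {b : ℝ}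
    (hb : 112 * U ^ 2 ≤ b) {p : Fin M → ℝ} (hp : ∀ j, 0 < p j) (hp1 : ∑ j, p j = 1) (j : Fin M) :
    Measure.pi (fun _ : Fin n => P) {s | ∃ θ : Fin M → ℝ,
        IsQAggregate (1 / 2) b p label f s θ ∧
        ¬ (∫ o, ((label o - ensemble f θ o.1) ^ 2 - (label o - f j o.1) ^ 2 +
            1 / 25 * (ensemble f θ o.1 - f j o.1) ^ 2) ∂P ≤
          b / n * Real.log (1 / p j) + 56 * U ^ 2 * (Real.log (1 / δ) / n))} ≤
      ENNReal.ofReal δ := by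
  have hn' : (0 : ℝ) < n := by exact_mod_cast hn
  have hU2 : 0 < 56 * U ^ 2 := by positivity
  set c : Fin M → Fin M → ℝ := fun k l =>
    ∫ o, (crossExcess (label o) (f j o.1) (f k o.1) (f l o.1) +
        1 / 50 * sqSpread (f j o.1) (f k o.1) (f l o.1)) ∂P with hc
  set ξ : Fin M → Fin M → Obs 𝒳 → ℝ := fun k l o =>
    crossExcess (label o) (f j o.1) (f k o.1) (f l o.1) +
        1 / 4 * sqSpread (f j o.1) (f k o.1) (f l o.1) with hξ
  have hdev : ∀ k l, Measure.pi (fun _ : Fin n => P)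
      {s | Real.log (1 / (p k * p l * δ)) < ∑ i, (c k l - ξ k l (s i)) / (56 * U ^ 2)} ≤
        ENNReal.ofReal (p k * p l * δ) := fun k l => by
    have h := integral_exp_crossExcess_le (P := P) hU hlabel ((hf j).comp measurable_fst)
      ((hf k).comp measurable_fst) ((hf l).comp measurable_fst) hlabelU (hfU j) (hfU k) (hfU l)
    exact pi_measure_lt_sum_le h.1 h.2 (mul_pos (mul_pos (hp k) (hp l)) hδ)
  -- The bad event for any minimizer lies in a union of events that do not mention `θ`; monotonicity
  -- of the outer measure avoids a measurable selection of minimizers.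
  calc _ ≤ Measure.pi (fun _ : Fin n => P) (⋃ k, ⋃ l,
        {s | Real.log (1 / (p k * p l * δ)) < ∑ i, (c k l - ξ k l (s i)) / (56 * U ^ 2)}) := by
        refine measure_mono ?_
        rintro s ⟨θ, hθ, hlt⟩
        by_contra hs
        simp only [Set.mem_iUnion, Set.mem_ofPred_eq, not_exists, not_lt] at hs
        refine hlt ((integral_excess_le_sum_sum hlabel hlabelU hf hfU hθ.1 j).trans ?_)
        have hgood : ∀ k l, n * c k l ≤ ∑ i, ξ k l (s i) + 56 * U ^ 2 * ((Real.log (1 / p k) +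
            Real.log (1 / p l)) + Real.log (1 / δ)) := fun k l => by
          have h1 := hs k l
          rw [← Finset.sum_div, div_le_iff₀ hU2, Finset.sum_sub_distrib] at h1
          have h2 : Real.log (1 / (p k * p l * δ)) =
              (Real.log (1 / p k) + Real.log (1 / p l)) + Real.log (1 / δ) := by
            simp only [one_div, Real.log_inv]
            rw [Real.log_mul (mul_pos (hp k) (hp l)).ne' hδ.ne',
              Real.log_mul (hp k).ne' (hp l).ne']
            ring
          rw [h2] at h1
          simp only [Finset.sum_const, Finset.card_univ, Fintype.card_fin, nsmul_eq_mul] at h1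
          linarith
        -- Averaging the pairwise bounds with weights `θ k * θ l` counts the prior cost once for
        -- each index, hence the factor `2`.
        have hsum : n * ∑ k, ∑ l, θ k * θ l * c k l ≤
            ∑ i, ∑ k, ∑ l, θ k * θ l * ξ k l (s i) +
              56 * U ^ 2 * (2 * ∑ k, θ k * Real.log (1 / p k) + Real.log (1 / δ)) := by
          calc _ = ∑ k, ∑ l, θ k * θ l * (n * c k l) := by
                simp only [Finset.mul_sum]
                exact Finset.sum_congr rfl fun k _ => Finset.sum_congr rfl fun l _ => by ring
            _ ≤ ∑ k, ∑ l, θ k * θ l * (∑ i, ξ k l (s i) + 56 * U ^ 2 * ((Real.log (1 / p k) +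
                  Real.log (1 / p l)) + Real.log (1 / δ))) :=
                Finset.sum_le_sum fun k _ => Finset.sum_le_sum fun l _ =>
                  mul_le_mul_of_nonneg_left (hgood k l) (mul_nonneg (hθ.1.1 k) (hθ.1.1 l))
            _ = ∑ k, ∑ l, ∑ i, θ k * θ l * ξ k l (s i) + 56 * U ^ 2 *
                  (∑ k, ∑ l, θ k * θ l * (Real.log (1 / p k) + Real.log (1 / p l)) +
                    ∑ k, ∑ l, θ k * θ l * Real.log (1 / δ)) := by
                simp only [← Finset.sum_add_distrib, Finset.mul_sum]
                refine Finset.sum_congr rfl fun k _ => Finset.sum_congr rfl fun l _ => ?_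
                rw [← Finset.mul_sum]
                ring
            _ = _ := by
                rw [sum_sum_mul_add hθ.1.2 fun k => Real.log (1 / p k), sum_sum_const hθ.1.2]
                congr 1
                calc _ = ∑ k, ∑ i, ∑ l, θ k * θ l * ξ k l (s i) :=
                      Finset.sum_congr rfl fun k _ => Finset.sum_comm
                  _ = _ := Finset.sum_comm
        have hopt := hθ.sum_crossExcess_le hn j
        have hK : 0 ≤ ∑ k, θ k * Real.log (1 / p k) := Finset.sum_nonneg fun k _ =>
          mul_nonneg (hθ.1.1 k) (Real.log_nonneg (one_le_one_div (hp k)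
            (hp1 ▸ Finset.single_le_sum (fun i _ => (hp i).le) (Finset.mem_univ k))))
        -- The doubled prior cost `2 · 56U²` is cancelled by the penalty in the objective; this is
        -- the origin of `112U²`.
        have hbK := mul_le_mul_of_nonneg_right hb hK
        rw [div_mul_eq_mul_div, ← mul_div_assoc, ← add_div, le_div_iff₀ hn']
        simp only [hξ] at hsum
        simp only [hc] at hsum
        linarith
    _ ≤ ∑ k, ∑ l, ENNReal.ofReal (p k * p l * δ) :=
        (measure_iUnion_fintype_le _ _).trans (Finset.sum_le_sum fun k _ =>
          (measure_iUnion_fintype_le _ _).trans (Finset.sum_le_sum fun l _ => hdev k l))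
    -- The failure probabilities `p k * p l * δ` sum to `δ` because the product prior has mass one.
    _ = ENNReal.ofReal δ := by
        have h0 : ∀ k l, 0 ≤ p k * p l * δ := fun k l =>
          (mul_pos (mul_pos (hp k) (hp l)) hδ).le
        simp only [← ENNReal.ofReal_sum_of_nonneg fun l _ => h0 _ l]
        rw [← ENNReal.ofReal_sum_of_nonneg fun k _ => Finset.sum_nonneg fun l _ => h0 k l,
          sum_sum_const hp1]

end OracleInequality

/-! ### Conditional expectations under randomization and conditioning on an event. -/

section ConditionalExpectation

variable {Ω : Type*}

theorem measurable_ind : Measurable ind := Measurable.of_discrete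

theorem abs_ind_le (b : Bool) : |ind b| ≤ 1 := by cases b <;> simp [ind]

theorem integrable_ind_mul [MeasurableSpace Ω] {μ : Measure Ω} {g : Ω → Bool}
    (hg : Measurable g) {k : Ω → ℝ} (hk : Integrable k μ) :
    Integrable (fun ω => ind (g ω) * k ω) μ :=
  hk.bdd_mul (measurable_ind.comp hg).aestronglyMeasurable
    (Filter.Eventually.of_forall fun ω => abs_ind_le (g ω))

/-- Two nonnegative weights with the same integrals over the events generated by `W` integrate
every function of `W` in the same way. -/
theorem integral_mul_comp_congr {β : Type*} [MeasurableSpace β] [MeasurableSpace Ω]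
    {μ : Measure Ω} {g h : Ω → ℝ} {W : Ω → β} (hW : Measurable W) (mg : Measurable g)
    (mh : Measurable h) (ig : Integrable g μ) (ih : Integrable h μ) (hg : 0 ≤ᵐ[μ] g)
    (hh : 0 ≤ᵐ[μ] h)
    (heq : ∀ t, MeasurableSet t → ∫ ω in W ⁻¹' t, g ω ∂μ = ∫ ω in W ⁻¹' t, h ω ∂μ)
    {φ : β → ℝ} (hφ : Measurable φ) :
    ∫ ω, g ω * φ (W ω) ∂μ = ∫ ω, h ω * φ (W ω) ∂μ := by
  -- Both sides are integrals of `φ` against the image under `W` of a measure with density; these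
  -- images coincide on measurable sets, so `φ` needs no integrability.
  have key : ∀ g : Ω → ℝ, Measurable g → 0 ≤ᵐ[μ] g → ∫ ω, g ω * φ (W ω) ∂μ =
      ∫ w, φ w ∂((μ.withDensity fun ω => ENNReal.ofReal (g ω)).map W) := fun g mg hg => by
    rw [integral_map hW.aemeasurable hφ.aestronglyMeasurable,
      integral_withDensity_eq_integral_toReal_smul mg.ennreal_ofReal
        (Filter.Eventually.of_forall fun _ => ENNReal.ofReal_lt_top)]
    refine integral_congr_ae ?_
    filter_upwards [hg] with ω h0
    rw [ENNReal.toReal_ofReal h0, smul_eq_mul]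
  have hset : ∀ g : Ω → ℝ, Integrable g μ → 0 ≤ᵐ[μ] g → ∀ t, MeasurableSet t →
      (μ.withDensity fun ω => ENNReal.ofReal (g ω)).map W t =
        ENNReal.ofReal (∫ ω in W ⁻¹' t, g ω ∂μ) := fun g ig hg t ht => by
    rw [Measure.map_apply hW ht, withDensity_apply _ (hW ht),
      ofReal_integral_eq_lintegral_ofReal ig.integrableOn (ae_restrict_of_ae hg)]
  rw [key g mg hg, key h mh hh]
  congr 1
  ext t ht
  rw [hset g ig hg t ht, hset h ih hh t ht, heq t ht]

/-- A centered binary variable is conditionally uncorrelated with every integrable function of a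
conditionally independent variable. -/
theorem condExp_ind_sub_mul_comp {m mΩ : MeasurableSpace Ω} [StandardBorelSpace Ω] {hm : m ≤ mΩ}
    {μ : Measure Ω} [IsProbabilityMeasure μ] {β : Type*} [MeasurableSpace β] {Z : Ω → Bool}
    {W : Ω → β} (hZ : Measurable Z) (hW : Measurable W) (hind : CondIndepFun m hm Z W μ)
    {e : Ω → ℝ} (me : StronglyMeasurable[m] e) (he : e =ᵐ[μ] μ[fun ω => ind (Z ω) | m])
    (he01 : ∀ᵐ ω ∂μ, 0 < e ω ∧ e ω < 1) {φ : β → ℝ} (mφ : Measurable φ)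
    (hφ : Integrable (fun ω => φ (W ω)) μ) :
    μ[fun ω => (ind (Z ω) - e ω) * φ (W ω) | m] =ᵐ[μ] fun _ => 0 := by
  have mζ : Measurable fun ω => ind (Z ω) := measurable_ind.comp hZ
  have me' : Measurable e := (me.mono hm).measurable
  have ζbd : ∀ ω, ‖ind (Z ω)‖ ≤ 1 := fun ω => by cases Z ω <;> simp [ind]
  have ebd : ∀ᵐ ω ∂μ, ‖e ω‖ ≤ 1 := by
    filter_upwards [he01] with ω h
    rw [Real.norm_eq_abs, abs_le]
    constructor <;> linarith [h.1, h.2]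
  have iζ : Integrable (fun ω => ind (Z ω)) μ :=
    Integrable.of_bound mζ.aestronglyMeasurable 1 (Filter.Eventually.of_forall ζbd)
  have ie : Integrable e μ := Integrable.of_bound me'.aestronglyMeasurable 1 ebd
  have iζφ : Integrable (fun ω => ind (Z ω) * φ (W ω)) μ :=
    hφ.bdd_mul mζ.aestronglyMeasurable (Filter.Eventually.of_forall ζbd)
  have ieφ : Integrable (fun ω => e ω * φ (W ω)) μ := hφ.bdd_mul me'.aestronglyMeasurable ebd
  -- Conditional independence gives `E[1_{W ∈ t} Z ∣ m] = e · Pr(W ∈ t ∣ m)`, integrated over `A`.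
  have hsets : ∀ A, MeasurableSet[m] A → ∀ t, MeasurableSet t →
      ∫ ω in W ⁻¹' t, ind (Z ω) ∂(μ.restrict A) = ∫ ω in W ⁻¹' t, e ω ∂(μ.restrict A) := by
    intro A hA t ht
    have hone : Integrable ((W ⁻¹' t).indicator fun _ => (1 : ℝ)) μ :=
      (integrable_const 1).indicator (hW ht)
    have hi := (condIndepFun_iff_condExp_inter_preimage_eq_mul hZ hW).1 hind {true} t
      (measurableSet_singleton _) ht
    have e1 : ((Z ⁻¹' {true}).indicator fun _ => (1 : ℝ)) = fun ω => ind (Z ω) := by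
      ext ω
      by_cases h : Z ω <;> simp [ind, Set.indicator, h]
    have e2 : ((Z ⁻¹' {true} ∩ W ⁻¹' t).indicator fun _ => (1 : ℝ)) =
        (W ⁻¹' t).indicator fun ω => ind (Z ω) := by
      rw [Set.inter_comm, ← Set.indicator_indicator, e1]
    have e3 : (W ⁻¹' t).indicator e = e * (W ⁻¹' t).indicator fun _ => (1 : ℝ) := by
      ext ω
      by_cases h : ω ∈ W ⁻¹' t <;> simp [h]
    have hpull := condExp_stronglyMeasurable_mul_of_bound hm me hone 1 ebd
    rw [← integral_indicator (hW ht), ← integral_indicator (hW ht),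
      ← setIntegral_condExp hm (iζ.indicator (hW ht)) hA,
      ← setIntegral_condExp hm (ie.indicator (hW ht)) hA]
    refine integral_congr_ae (ae_restrict_of_ae ?_)
    rw [e1, e2] at hi
    rw [e3]
    filter_upwards [hi, hpull, he] with ω h1 h2 h3
    rw [h1, h2, Pi.mul_apply, h3]
  have hint : ∀ A, MeasurableSet[m] A →
      ∫ ω in A, ind (Z ω) * φ (W ω) ∂μ = ∫ ω in A, e ω * φ (W ω) ∂μ := fun A hA =>
    integral_mul_comp_congr hW mζ me' iζ.integrableOn ie.integrableOn
      (Filter.Eventually.of_forall fun ω => by cases h : Z ω <;> simp [ind, h])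
      (ae_restrict_of_ae (he01.mono fun ω h => h.1.le)) (hsets A hA) mφ
  have e4 : (fun ω => (ind (Z ω) - e ω) * φ (W ω)) =
      fun ω => ind (Z ω) * φ (W ω) - e ω * φ (W ω) := by
    ext ω
    ring
  rw [e4]
  refine (ae_eq_condExp_of_forall_setIntegral_eq hm (iζφ.sub ieφ)
    (fun _ _ _ => integrableOn_zero) (fun A hA _ => ?_)
    stronglyMeasurable_const.aestronglyMeasurable).symm
  simp only [Pi.sub_apply]
  rw [integral_sub iζφ.integrableOn ieφ.integrableOn, hint A hA, sub_self, integral_zero]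

/-- The conditional covariance of the assignment with a response that is affine in the
assignment. -/
theorem condExp_ind_sub_mul_affine {m mΩ : MeasurableSpace Ω} [StandardBorelSpace Ω]
    {hm : m ≤ mΩ} {μ : Measure Ω} [IsProbabilityMeasure μ] {β : Type*} [MeasurableSpace β]
    {Z : Ω → Bool} {W : Ω → β} (hZ : Measurable Z) (hW : Measurable W)
    (hind : CondIndepFun m hm Z W μ) {e : Ω → ℝ} (me : StronglyMeasurable[m] e)
    (he : e =ᵐ[μ] μ[fun ω => ind (Z ω) | m]) (he01 : ∀ᵐ ω ∂μ, 0 < e ω ∧ e ω < 1)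
    {φ ψ : β → ℝ} (mφ : Measurable φ) (hφ : Integrable (fun ω => φ (W ω)) μ)
    (mψ : Measurable ψ) (hψ : Integrable (fun ω => ψ (W ω)) μ) :
    μ[fun ω => (φ (W ω) + ind (Z ω) * ψ (W ω)) * (ind (Z ω) - e ω) | m] =ᵐ[μ]
      fun ω => e ω * (1 - e ω) * (μ[fun ω' => ψ (W ω') | m]) ω := by
  have mζ : Measurable fun ω => ind (Z ω) := measurable_ind.comp hZ
  have me' : Measurable e := (me.mono hm).measurable
  have h1e : StronglyMeasurable[m] (fun ω => 1 - e ω) := stronglyMeasurable_const.sub me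
  have bd1 : ∀ᵐ ω ∂μ, ‖1 - e ω‖ ≤ 1 := by
    filter_upwards [he01] with ω h
    rw [Real.norm_eq_abs, abs_le]
    constructor <;> linarith [h.1, h.2]
  have bd2 : ∀ᵐ ω ∂μ, ‖e ω * (1 - e ω)‖ ≤ 1 := by
    filter_upwards [he01] with ω h
    rw [Real.norm_eq_abs, abs_le]
    constructor <;> nlinarith [h.1, h.2]
  have bd3 : ∀ᵐ ω ∂μ, ‖ind (Z ω) - e ω‖ ≤ 1 := by
    filter_upwards [he01] with ω h
    rw [Real.norm_eq_abs, abs_le]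
    cases Z ω <;> simp only [ind, Bool.false_eq_true, if_true, if_false] <;>
      constructor <;> linarith [h.1, h.2]
  have i1 : Integrable (fun ω => (ind (Z ω) - e ω) * φ (W ω)) μ :=
    hφ.bdd_mul (mζ.sub me').aestronglyMeasurable bd3
  have i2 : Integrable (fun ω => (ind (Z ω) - e ω) * ψ (W ω)) μ :=
    hψ.bdd_mul (mζ.sub me').aestronglyMeasurable bd3
  have i2' : Integrable ((fun ω => 1 - e ω) * fun ω => (ind (Z ω) - e ω) * ψ (W ω)) μ :=
    i2.bdd_mul (measurable_const.sub me').aestronglyMeasurable bd1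
  have i3 : Integrable ((fun ω => e ω * (1 - e ω)) * fun ω => ψ (W ω)) μ :=
    hψ.bdd_mul (me'.mul (measurable_const.sub me')).aestronglyMeasurable bd2
  -- For binary `Z`, `Z(Z - e) = (1 - e)(Z - e) + e(1 - e)`; only the last term survives
  -- conditioning.
  have e1 : (fun ω => (φ (W ω) + ind (Z ω) * ψ (W ω)) * (ind (Z ω) - e ω)) =
      (fun ω => (ind (Z ω) - e ω) * φ (W ω)) +
        ((fun ω => 1 - e ω) * fun ω => (ind (Z ω) - e ω) * ψ (W ω)) +
        ((fun ω => e ω * (1 - e ω)) * fun ω => ψ (W ω)) := by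
    ext ω
    simp only [Pi.add_apply, Pi.mul_apply]
    cases Z ω <;> simp only [ind, Bool.false_eq_true, if_true, if_false] <;> ring
  rw [e1]
  filter_upwards [condExp_add (i1.add i2') i3 m, condExp_add i1 i2' m,
    condExp_stronglyMeasurable_mul_of_bound hm h1e i2 1 bd1,
    condExp_stronglyMeasurable_mul_of_bound hm (me.mul h1e) hψ 1 bd2,
    condExp_ind_sub_mul_comp hZ hW hind me he he01 mφ hφ,
    condExp_ind_sub_mul_comp hZ hW hind me he he01 mψ hψ] with ω h1 h2 h3 h4 h5 h6
  rw [h1, Pi.add_apply, h2, Pi.add_apply, h3, Pi.mul_apply, h5, h6]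
  have h4' : (μ[(fun ω => e ω * (1 - e ω)) * fun ω => ψ (W ω) | m]) ω =
    e ω * (1 - e ω) * (μ[fun ω' => ψ (W ω') | m]) ω := h4
  rw [h4']
  ring

/-- A conditional expectation under the measure conditioned on an event, in terms of the original
measure. -/
theorem condExp_indicator_eq_of_cond {m mΩ : MeasurableSpace Ω} (hm : m ≤ mΩ) {μ : Measure Ω}
    [IsProbabilityMeasure μ] {S : Set Ω} (hS : MeasurableSet S) (hS0 : μ S ≠ 0) {g t : Ω → ℝ}
    (hg : Integrable g μ) (mt : StronglyMeasurable[m] t)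
    (ht : t =ᵐ[cond μ S] condExp m (cond μ S) g) :
    μ[S.indicator g | m] =ᵐ[μ] fun ω => t ω * (μ[S.indicator (fun _ => (1 : ℝ)) | m]) ω := by
  have := cond_isProbabilityMeasure hS0
  have hinv0 : (μ S)⁻¹ ≠ 0 := ENNReal.inv_ne_zero.2 (measure_ne_top μ S)
  have hinv : (μ S)⁻¹ ≠ ∞ := ENNReal.inv_ne_top.2 hS0
  have hgc : Integrable g (cond μ S) := hg.restrict.smul_measure hinv
  have htc : Integrable t (cond μ S) := (integrable_congr ht).2 integrable_condExp
  have htS : IntegrableOn t S μ := (integrable_smul_measure hinv0 hinv).1 htc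
  have hset : ∀ h : Ω → ℝ, ∀ A, MeasurableSet[m] A →
      ∫ ω in A, h ω ∂(cond μ S) = (μ S)⁻¹.toReal * ∫ ω in A, S.indicator h ω ∂μ := by
    intro h A hA
    rw [ProbabilityTheory.cond, Measure.restrict_smul, integral_smul_measure, smul_eq_mul,
      Measure.restrict_restrict (hm A hA), setIntegral_indicator hS]
  have hinv' : (μ S)⁻¹.toReal ≠ 0 := ENNReal.toReal_ne_zero.2 ⟨hinv0, hinv⟩
  -- On each `m`-measurable set the two conditioned integrals agree, and the normalization `(μ S)⁻¹`
  -- cancels. Only integrability of `t` on `S` is available, so `t` is pulled out after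
  -- multiplication by the indicator.
  have h1 : μ[S.indicator t | m] =ᵐ[μ] μ[S.indicator g | m] := by
    refine ae_eq_condExp_of_forall_setIntegral_eq hm (hg.indicator hS)
      (fun _ _ _ => integrable_condExp.integrableOn) (fun A hA _ => ?_)
      stronglyMeasurable_condExp.aestronglyMeasurable
    rw [setIntegral_condExp hm (htS.integrable_indicator hS) hA]
    refine mul_left_cancel₀ hinv' ?_
    rw [← hset t A hA, ← hset g A hA, ← setIntegral_condExp hm hgc hA]
    exact integral_congr_ae (ae_restrict_of_ae ht)
  have e1 : S.indicator t = t * S.indicator fun _ => (1 : ℝ) := by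
    ext ω
    by_cases h : ω ∈ S <;> simp [h]
  refine h1.symm.trans ?_
  have h2 := htS.integrable_indicator hS
  rw [e1] at h2 ⊢
  exact condExp_mul_of_stronglyMeasurable_left mt h2 ((integrable_const 1).indicator hS)

/-- Conditional expectation of an integrable combination with coefficients that are measurable,
but not necessarily such that the single terms are integrable. -/
theorem condExp_add_mul_add_mul {m mΩ : MeasurableSpace Ω} (hm : m ≤ mΩ) {μ : Measure Ω}
    [IsProbabilityMeasure μ] {a b c P Q : Ω → ℝ} (ma : Measurable[m] a)
    (mb : Measurable[m] b) (mc : Measurable[m] c) (hP : Integrable P μ)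
    (hQ : Integrable Q μ) (hV : Integrable (fun ω => a ω + b ω * P ω + c ω * Q ω) μ) :
    μ[fun ω => a ω + b ω * P ω + c ω * Q ω | m] =ᵐ[μ]
      fun ω => a ω + b ω * (μ[P | m]) ω + c ω * (μ[Q | m]) ω := by
  -- A strictly positive `m`-measurable weight that makes all coefficients bounded: linearity holds
  -- after multiplication by `w`, which is then cancelled.
  set w : Ω → ℝ := fun ω => (1 + |a ω| + |b ω| + |c ω|)⁻¹ with hw
  have mw : Measurable[m] w := by
    have h : Measurable fun q : ℝ × ℝ × ℝ => (1 + |q.1| + |q.2.1| + |q.2.2|)⁻¹ := by fun_prop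
    exact h.comp (ma.prodMk (mb.prodMk mc))
  have pos : ∀ ω, 0 < 1 + |a ω| + |b ω| + |c ω| := fun ω => by positivity
  have wpos : ∀ ω, 0 < w ω := fun ω => inv_pos.2 (pos ω)
  have wbd : ∀ (ω : Ω) (x : ℝ), |x| ≤ 1 + |a ω| + |b ω| + |c ω| → ‖w ω * x‖ ≤ 1 := fun ω x h => by
    rw [Real.norm_eq_abs, abs_mul, abs_of_pos (wpos ω), hw, inv_mul_le_iff₀ (pos ω), mul_one]
    exact h
  have bda : ∀ᵐ ω ∂μ, ‖w ω * a ω‖ ≤ 1 := Filter.Eventually.of_forall fun ω =>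
    wbd ω _ (by linarith [abs_nonneg (b ω), abs_nonneg (c ω)])
  have bdb : ∀ᵐ ω ∂μ, ‖(w * b) ω‖ ≤ 1 := Filter.Eventually.of_forall fun ω =>
    wbd ω _ (by linarith [abs_nonneg (a ω), abs_nonneg (c ω)])
  have bdc : ∀ᵐ ω ∂μ, ‖(w * c) ω‖ ≤ 1 := Filter.Eventually.of_forall fun ω =>
    wbd ω _ (by linarith [abs_nonneg (a ω), abs_nonneg (b ω)])
  have bdw : ∀ᵐ ω ∂μ, ‖w ω‖ ≤ 1 := Filter.Eventually.of_forall fun ω => by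
    have h1 : |(1 : ℝ)| ≤ 1 + |a ω| + |b ω| + |c ω| := by
      rw [abs_one]
      linarith [abs_nonneg (a ω), abs_nonneg (b ω), abs_nonneg (c ω)]
    simpa only [mul_one] using wbd ω 1 h1
  have ia : Integrable (fun ω => w ω * a ω) μ :=
    Integrable.of_bound ((mw.mul ma).mono hm le_rfl).aestronglyMeasurable 1 bda
  have ib : Integrable ((w * b) * P) μ :=
    hP.bdd_mul ((mw.mul mb).mono hm le_rfl).aestronglyMeasurable bdb
  have ic : Integrable ((w * c) * Q) μ :=
    hQ.bdd_mul ((mw.mul mc).mono hm le_rfl).aestronglyMeasurable bdc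
  have e1 : (w * fun ω => a ω + b ω * P ω + c ω * Q ω) =
      (fun ω => w ω * a ω) + (w * b) * P + (w * c) * Q := by
    ext ω
    simp only [Pi.mul_apply, Pi.add_apply]
    ring
  have h0 := condExp_stronglyMeasurable_mul_of_bound hm mw.stronglyMeasurable hV 1 bdw
  rw [e1] at h0
  have ha : μ[fun ω => w ω * a ω | m] = fun ω => w ω * a ω :=
    condExp_of_stronglyMeasurable hm (mw.mul ma).stronglyMeasurable ia
  filter_upwards [h0, condExp_add (ia.add ib) ic m, condExp_add ia ib m,
    condExp_stronglyMeasurable_mul_of_bound hm (mw.mul mb).stronglyMeasurable hP 1 bdb,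
    condExp_stronglyMeasurable_mul_of_bound hm (mw.mul mc).stronglyMeasurable hQ 1 bdc]
    with ω h0 h1 h2 h3 h4
  refine mul_left_cancel₀ (wpos ω).ne' ?_
  rw [Pi.mul_apply] at h0
  rw [← h0, h1, Pi.add_apply, h2, Pi.add_apply, h3, h4, ha]
  simp only [Pi.mul_apply]
  ring

end ConditionalExpectation

/-! ### Identification of the complier effect and the mean of the pseudo-outcome. -/

namespace IVTrial

variable {Ω 𝒳 : Type*} [MeasurableSpace 𝒳] {T : IVTrial Ω 𝒳}

section Stratified

variable [MeasurableSpace Ω] [StandardBorelSpace Ω] {μ : Measure Ω} [IsProbabilityMeasure μ]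
  {π₀ : 𝒳 → ℝ}

theorem IsStratified.measurable_D (h : T.IsStratified μ π₀) : Measurable T.D := by
  have e : T.D = fun ω => if T.Z ω = true then T.Dpot true ω else T.Dpot false ω := by
    ext ω
    cases hZ : T.Z ω <;> simp [D, hZ]
  rw [e]
  exact Measurable.ite (h.measurable_Z (measurableSet_singleton true)) (h.measurable_Dpot _)
    (h.measurable_Dpot _)

theorem IsStratified.measurable_Y (h : T.IsStratified μ π₀) : Measurable T.Y := by
  have e : T.Y = fun ω => if T.D ω = true then T.Ypot true ω else T.Ypot false ω := by
    ext ω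
    cases hD : T.D ω <;> simp [Y, hD]
  rw [e]
  exact Measurable.ite (h.measurable_D (measurableSet_singleton true)) (h.measurable_Ypot _)
    (h.measurable_Ypot _)

theorem IsStratified.measurable_obs (h : T.IsStratified μ π₀) : Measurable T.obs :=
  h.measurable_X.prodMk (h.measurable_Z.prodMk (h.measurable_D.prodMk h.measurable_Y))

theorem IsStratified.measurable_potentials (h : T.IsStratified μ π₀) : Measurable T.potentials :=
  (h.measurable_Dpot _).prodMk ((h.measurable_Dpot _).prodMk
    ((h.measurable_Ypot _).prodMk (h.measurable_Ypot _)))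

theorem IsStratified.measurableSet_compliers (h : T.IsStratified μ π₀) :
    MeasurableSet T.compliers := by
  have e : T.compliers = T.Dpot false ⁻¹' {false} ∩ T.Dpot true ⁻¹' {true} := by
    ext ω
    simp only [compliers, Set.mem_ofPred_eq, Set.mem_inter_iff, Set.mem_preimage,
      Set.mem_singleton_iff]
    cases T.Dpot false ω <;> cases T.Dpot true ω <;> decide
  rw [e]
  exact (h.measurable_Dpot _ (measurableSet_singleton _)).inter
    (h.measurable_Dpot _ (measurableSet_singleton _))

theorem IsStratified.compliers_ne_zero (h : T.IsStratified μ π₀) : μ T.compliers ≠ 0 := by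
  intro h0
  have h1 : T.compliers.indicator (fun _ => (1 : ℝ)) =ᵐ[μ] 0 :=
    indicator_meas_zero h0
  have h2 := (condExp_congr_ae (m := T.sigmaX) h1).trans
    (Filter.EventuallyEq.of_eq condExp_zero)
  obtain ⟨ω, h3, h4⟩ := (h.relevant.and h2).exists
  rw [h4] at h3
  exact lt_irrefl _ h3

theorem IsStratified.integrable_mul_sub (h : T.IsStratified μ π₀) {k : Ω → ℝ}
    (hk : Integrable k μ) : Integrable (fun ω => k ω * (ind (T.Z ω) - π₀ (T.X ω))) μ := by
  refine hk.mul_bdd (c := 1) ((measurable_ind.comp h.measurable_Z).sub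
    (h.measurable_propensity.comp h.measurable_X)).aestronglyMeasurable ?_
  filter_upwards [h.overlap] with ω h
  rw [Real.norm_eq_abs, abs_le]
  cases T.Z ω <;> simp only [ind, Bool.false_eq_true, if_true, if_false] <;>
    constructor <;> linarith [h.1, h.2]

theorem IsStratified.integrable_D (h : T.IsStratified μ π₀) :
    Integrable (fun ω => ind (T.D ω)) μ := by
  simpa only [mul_one] using integrable_ind_mul h.measurable_D (integrable_const (1 : ℝ))

theorem IsStratified.integrable_Y (h : T.IsStratified μ π₀) : Integrable T.Y μ := by
  have e : T.Y = fun ω => T.Ypot false ω +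
      ind (T.D ω) * (T.Ypot true ω - T.Ypot false ω) := by
    ext ω
    cases hD : T.D ω <;> simp [Y, hD, ind]
  rw [e]
  exact (h.integrable_Ypot _).add (integrable_ind_mul h.measurable_D
    ((h.integrable_Ypot _).sub (h.integrable_Ypot _)))

/-- The effect of the assignment on a response `k d` to the treatment is carried by the
compliers. -/
theorem IsStratified.ae_sub_mul_eq_indicator (h : T.IsStratified μ π₀) (k : Ω → ℝ) :
    (fun ω => (ind (T.Dpot true ω) - ind (T.Dpot false ω)) * k ω) =ᵐ[μ]
      T.compliers.indicator k := by
  filter_upwards [h.monotone] with ω hω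
  by_cases hc : ω ∈ T.compliers
  · rw [Set.indicator_of_mem hc]
    simp only [compliers, Set.mem_ofPred_eq] at hc
    revert hc
    cases T.Dpot false ω <;> cases T.Dpot true ω <;> simp [ind]
  · rw [Set.indicator_of_notMem hc]
    simp only [compliers, Set.mem_ofPred_eq] at hc
    revert hc hω
    cases T.Dpot false ω <;> cases T.Dpot true ω <;> simp [ind]

/-- `D` is affine in `Z` with slope `D(1) - D(0)`, which by monotonicity is the indicator of
compliance. -/
theorem IsStratified.condExp_D_mul (h : T.IsStratified μ π₀) :
    μ[fun ω => ind (T.D ω) * (ind (T.Z ω) - π₀ (T.X ω)) | T.sigmaX] =ᵐ[μ]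
      fun ω => π₀ (T.X ω) * (1 - π₀ (T.X ω)) *
        (μ[T.compliers.indicator (fun _ => (1 : ℝ)) | T.sigmaX]) ω := by
  have i0 : ∀ z, Integrable (fun ω => ind (T.Dpot z ω)) μ := fun z => by
    simpa only [mul_one] using
      integrable_ind_mul (h.measurable_Dpot z) (integrable_const (1 : ℝ))
  have key := condExp_ind_sub_mul_affine h.measurable_Z h.measurable_potentials h.randomized
    (h.measurable_propensity.comp (comap_measurable T.X)).stronglyMeasurable h.propensity
    h.overlap (φ := fun w => ind w.1) (ψ := fun w => ind w.2.1 - ind w.1)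
    (measurable_ind.comp measurable_fst) (i0 false)
    ((measurable_ind.comp measurable_snd.fst).sub (measurable_ind.comp measurable_fst))
    ((i0 true).sub (i0 false))
  have e : (fun ω => ind (T.D ω) * (ind (T.Z ω) - π₀ (T.X ω))) = fun ω =>
      (ind (T.potentials ω).1 + ind (T.Z ω) *
        (ind (T.potentials ω).2.1 - ind (T.potentials ω).1)) *
          (ind (T.Z ω) - (π₀ ∘ T.X) ω) := by
    ext ω
    simp only [potentials, Function.comp_apply, D]
    cases hZ : T.Z ω <;> simp [ind]
  have h2 := h.ae_sub_mul_eq_indicator fun _ => 1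
  simp only [mul_one] at h2
  rw [e]
  filter_upwards [key, condExp_congr_ae (m := T.sigmaX) h2] with ω h3 h4
  rw [h3, ← h4]
  rfl

/-- The slope of `Y` in `Z` is `Y(1) - Y(0)` on the compliers and zero elsewhere. Its conditional
mean is `τ₀` times the conditional share of compliers, and the remaining factors recombine into
`β₀`: the conditional Wald identity. -/
theorem IsStratified.condExp_Y_mul (h : T.IsStratified μ π₀) {τ₀ β₀ : 𝒳 → ℝ}
    (hτ : T.IsCLATE μ τ₀) (hβ : T.IsCompliance μ π₀ β₀) :
    μ[fun ω => T.Y ω * (ind (T.Z ω) - π₀ (T.X ω)) | T.sigmaX] =ᵐ[μ]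
      fun ω => τ₀ (T.X ω) * β₀ (T.X ω) := by
  have iΔ : Integrable (fun ω => T.Ypot true ω - T.Ypot false ω) μ :=
    (h.integrable_Ypot true).sub (h.integrable_Ypot false)
  have i0 : ∀ z, Integrable (fun ω => ind (T.Dpot z ω) *
      (T.Ypot true ω - T.Ypot false ω)) μ := fun z =>
    integrable_ind_mul (h.measurable_Dpot z) iΔ
  have m1 : Measurable fun w : Bool × Bool × ℝ × ℝ => ind w.1 := measurable_ind.comp measurable_fst
  have m2 : Measurable fun w : Bool × Bool × ℝ × ℝ => ind w.2.1 :=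
    measurable_ind.comp measurable_snd.fst
  have key := condExp_ind_sub_mul_affine h.measurable_Z h.measurable_potentials h.randomized
    (h.measurable_propensity.comp (comap_measurable T.X)).stronglyMeasurable h.propensity
    h.overlap (φ := fun w => w.2.2.1 + ind w.1 * (w.2.2.2 - w.2.2.1))
    (ψ := fun w => ind w.2.1 * (w.2.2.2 - w.2.2.1) - ind w.1 * (w.2.2.2 - w.2.2.1))
    (by fun_prop) ((h.integrable_Ypot false).add (i0 false)) (by fun_prop)
    ((i0 true).sub (i0 false))
  have e : (fun ω => T.Y ω * (ind (T.Z ω) - π₀ (T.X ω))) = fun ω =>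
      ((T.potentials ω).2.2.1 + ind (T.potentials ω).1 *
          ((T.potentials ω).2.2.2 - (T.potentials ω).2.2.1) + ind (T.Z ω) *
        (ind (T.potentials ω).2.1 * ((T.potentials ω).2.2.2 - (T.potentials ω).2.2.1) -
          ind (T.potentials ω).1 * ((T.potentials ω).2.2.2 - (T.potentials ω).2.2.1))) *
          (ind (T.Z ω) - (π₀ ∘ T.X) ω) := by
    ext ω
    simp only [potentials, Function.comp_apply, Y, D]
    cases T.Z ω <;> cases T.Dpot true ω <;> cases T.Dpot false ω <;> simp [ind]
  have h2 := h.ae_sub_mul_eq_indicator fun ω => T.Ypot true ω - T.Ypot false ω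
  simp only [sub_mul] at h2
  have hcond := condExp_indicator_eq_of_cond h.measurable_X.comap_le h.measurableSet_compliers
    h.compliers_ne_zero iΔ (hτ.measurable.comp (comap_measurable T.X)).stronglyMeasurable
    hτ.version
  rw [e]
  filter_upwards [key, condExp_congr_ae (m := T.sigmaX) h2, hcond, hβ.version, h.condExp_D_mul]
    with ω h3 h4 h5 h6 h7
  rw [h3, h6, h7]
  change π₀ (T.X ω) * (1 - π₀ (T.X ω)) * (μ[fun ω => ind (T.Dpot true ω) *
    (T.Ypot true ω - T.Ypot false ω) - ind (T.Dpot false ω) *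
      (T.Ypot true ω - T.Ypot false ω) | T.sigmaX]) ω = _
  rw [h4, h5, Function.comp_apply]
  ring

/-- The conditional mean of the doubly robust pseudo-outcome. -/
theorem IsStratified.condExp_pseudoOutcome (h : T.IsStratified μ π₀) {τ₀ β₀ τ β : 𝒳 → ℝ}
    (hτ₀ : T.IsCLATE μ τ₀) (hβ₀ : T.IsCompliance μ π₀ β₀) (hτ : Measurable τ)
    (hβ : Measurable β)
    (hint : Integrable (fun ω => pseudoOutcome π₀ τ β (T.obs ω)) μ) :
    μ[fun ω => pseudoOutcome π₀ τ β (T.obs ω) | T.sigmaX] =ᵐ[μ]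
      fun ω => τ (T.X ω) + (τ₀ (T.X ω) - τ (T.X ω)) * (β₀ (T.X ω) / β (T.X ω)) := by
  have e : (fun ω => pseudoOutcome π₀ τ β (T.obs ω)) = fun ω =>
      τ (T.X ω) + (β (T.X ω))⁻¹ * (T.Y ω * (ind (T.Z ω) - π₀ (T.X ω))) +
        -(τ (T.X ω) * (β (T.X ω))⁻¹) * (ind (T.D ω) * (ind (T.Z ω) - π₀ (T.X ω))) := by
    ext ω
    simp only [pseudoOutcome, obs]
    ring
  rw [e] at hint ⊢
  have mβ : Measurable[T.sigmaX] fun ω => (β (T.X ω))⁻¹ := hβ.inv.comp (comap_measurable T.X)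
  have mτβ : Measurable[T.sigmaX] fun ω => -(τ (T.X ω) * (β (T.X ω))⁻¹) :=
    (hτ.mul hβ.inv).neg.comp (comap_measurable T.X)
  filter_upwards [condExp_add_mul_add_mul h.measurable_X.comap_le
    (hτ.comp (comap_measurable T.X)) mβ mτβ
    (h.integrable_mul_sub h.integrable_Y) (h.integrable_mul_sub h.integrable_D) hint,
    h.condExp_Y_mul hτ₀ hβ₀, hβ₀.version] with ω h1 h2 h3
  refine h1.trans ?_
  rw [h2, ← h3]
  simp only [Function.comp_apply]
  ring

end Stratified

end IVTrial

/-! ### From excess risk for a biased label to distance from the target. -/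

section Transfer

/-- Transfer of an excess risk with respect to a biased label to the distance from the target. -/
theorem integral_sq_sub_target_le {Ω : Type*} {m mΩ : MeasurableSpace Ω} (hm : m ≤ mΩ)
    {μ : Measure Ω} [IsProbabilityMeasure μ] {U : ℝ} {y F G t B : Ω → ℝ} (my : Measurable y)
    (hy : ∀ᵐ ω ∂μ, |y ω| ≤ U) (mF : Measurable[m] F) (hF : ∀ᵐ ω ∂μ, |F ω| ≤ U)
    (mG : Measurable[m] G) (hG : ∀ᵐ ω ∂μ, |G ω| ≤ U)
    (hyB : (fun ω => (μ[y | m]) ω - t ω) =ᵐ[μ] B)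
    (hB : Integrable (fun ω => B ω ^ 2) μ)
    (iF : Integrable (fun ω => (F ω - t ω) ^ 2) μ)
    (iG : Integrable (fun ω => (G ω - t ω) ^ 2) μ) :
    ∫ ω, (F ω - t ω) ^ 2 ∂μ ≤ ∫ ω, (G ω - t ω) ^ 2 ∂μ +
      ∫ ω, ((y ω - F ω) ^ 2 - (y ω - G ω) ^ 2 + 1 / 25 * (F ω - G ω) ^ 2) ∂μ +
      25 * ∫ ω, B ω ^ 2 ∂μ := by
  have mF' : Measurable F := mF.mono hm le_rfl
  have mG' : Measurable G := mG.mono hm le_rfl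
  have iy : Integrable y μ := integrable_of_abs_le my U hy
  have bd : ∀ᵐ ω ∂μ, ‖(F - G) ω‖ ≤ 2 * U := by
    filter_upwards [hF, hG] with ω h1 h2
    rw [Real.norm_eq_abs, Pi.sub_apply, abs_le]
    rw [abs_le] at h1 h2
    constructor <;> linarith
  have iFG : Integrable (fun ω => (F ω - G ω) ^ 2) μ := by
    refine integrable_of_abs_le (by fun_prop) ((2 * U) ^ 2) ?_
    filter_upwards [bd] with ω h
    rw [abs_of_nonneg (sq_nonneg _), ← sq_abs]
    exact pow_le_pow_left₀ (abs_nonneg _) h 2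
  have iFG' : Integrable (fun ω => F ω ^ 2 - G ω ^ 2) μ := by
    refine integrable_of_abs_le (by fun_prop) (2 * U * (2 * U)) ?_
    filter_upwards [bd, hF, hG] with ω h h1 h2
    rw [sq_sub_sq, abs_mul, mul_comm]
    exact mul_le_mul h ((abs_add_le _ _).trans (by linarith)) (abs_nonneg _)
      ((abs_nonneg _).trans h)
  have ify : Integrable ((F - G) * y) μ :=
    iy.bdd_mul (mF'.sub mG').aestronglyMeasurable bd
  have ifm : Integrable ((F - G) * μ[y | m]) μ :=
    integrable_condExp.bdd_mul (mF'.sub mG').aestronglyMeasurable bd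
  -- Since `F - G` is `m`-measurable and bounded, the label may be replaced by its conditional mean
  -- in the cross term.
  have hpull : ∫ ω, ((F - G) * μ[y | m]) ω ∂μ = ∫ ω, ((F - G) * y) ω ∂μ := by
    rw [← integral_condExp hm (f := (F - G) * y)]
    exact integral_congr_ae (condExp_stronglyMeasurable_mul_of_bound hm
      (mF.sub mG).stronglyMeasurable iy _ bd).symm
  have e1 : ∫ ω, ((y ω - F ω) ^ 2 - (y ω - G ω) ^ 2 + 1 / 25 * (F ω - G ω) ^ 2) ∂μ =
      ∫ ω, (F ω ^ 2 - G ω ^ 2) ∂μ - 2 * ∫ ω, ((F - G) * y) ω ∂μ +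
        1 / 25 * ∫ ω, (F ω - G ω) ^ 2 ∂μ := by
    have i1 : Integrable (fun ω => F ω ^ 2 - G ω ^ 2 - 2 * ((F - G) * y) ω) μ :=
      iFG'.sub (ify.const_mul 2)
    rw [← integral_const_mul, ← integral_const_mul, ← integral_sub iFG' (ify.const_mul 2),
      ← integral_add i1 (iFG.const_mul _)]
    refine integral_congr_ae (Filter.Eventually.of_forall fun ω => ?_)
    simp only [Pi.mul_apply, Pi.sub_apply]
    ring
  have e2 : ∫ ω, ((G ω - t ω) ^ 2 + ((F ω ^ 2 - G ω ^ 2) - 2 * ((F - G) * μ[y | m]) ω +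
        1 / 25 * (F ω - G ω) ^ 2) + 25 * B ω ^ 2) ∂μ =
      ∫ ω, (G ω - t ω) ^ 2 ∂μ + (∫ ω, (F ω ^ 2 - G ω ^ 2) ∂μ -
        2 * ∫ ω, ((F - G) * μ[y | m]) ω ∂μ + 1 / 25 * ∫ ω, (F ω - G ω) ^ 2 ∂μ) +
        25 * ∫ ω, B ω ^ 2 ∂μ := by
    have i1 : Integrable (fun ω => F ω ^ 2 - G ω ^ 2 - 2 * ((F - G) * μ[y | m]) ω) μ :=
      iFG'.sub (ifm.const_mul 2)
    have i2 : Integrable (fun ω => F ω ^ 2 - G ω ^ 2 - 2 * ((F - G) * μ[y | m]) ω +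
        1 / 25 * (F ω - G ω) ^ 2) μ := i1.add (iFG.const_mul (1 / 25))
    have i3 : Integrable (fun ω => (G ω - t ω) ^ 2 + (F ω ^ 2 - G ω ^ 2 -
        2 * ((F - G) * μ[y | m]) ω + 1 / 25 * (F ω - G ω) ^ 2)) μ := iG.add i2
    rw [← integral_const_mul, ← integral_const_mul, ← integral_const_mul,
      ← integral_sub iFG' (ifm.const_mul 2), ← integral_add i1 (iFG.const_mul _),
      ← integral_add iG i2, ← integral_add i3 (hB.const_mul _)]
  rw [e1, ← hpull, ← e2]
  refine integral_mono_ae iF (((iG.add ((iFG'.sub (ifm.const_mul 2)).add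
    (iFG.const_mul _))).add (hB.const_mul _))) ?_
  filter_upwards [hyB] with ω h
  simp only [Pi.mul_apply, Pi.sub_apply]
  rw [← h]
  -- With `B` the bias, the cross term satisfies `2(F - G)B ≤ (F - G)²/25 + 25B²`.
  nlinarith [sq_nonneg ((F ω - G ω) - 25 * ((μ[y | m]) ω - t ω))]

/-- The target itself is not assumed bounded, but it differs from the bounded conditional mean of
the label by the square-integrable bias. -/
theorem integrable_sq_sub_target {Ω : Type*} {m mΩ : MeasurableSpace Ω}
    {μ : Measure Ω} [IsProbabilityMeasure μ] {U : ℝ} {y F t B : Ω → ℝ}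
    (hy : ∀ᵐ ω ∂μ, |y ω| ≤ U) (mF : Measurable F) (hF : ∀ᵐ ω ∂μ, |F ω| ≤ U)
    (mt : Measurable t) (hyB : (fun ω => (μ[y | m]) ω - t ω) =ᵐ[μ] B)
    (hB : Integrable (fun ω => B ω ^ 2) μ) :
    Integrable (fun ω => (F ω - t ω) ^ 2) μ := by
  have hm := ae_bdd_abs_condExp_of_ae_bdd_abs (m := m) hy
  refine Integrable.mono' ((hB.const_mul 2).add (integrable_const (2 * (U + U) ^ 2)))
    (by fun_prop) ?_
  filter_upwards [hF, hm, hyB] with ω h1 h2 h3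
  rw [Real.norm_eq_abs, abs_of_nonneg (sq_nonneg _), Pi.add_apply, ← h3]
  have h4 : (F ω - (μ[y | m]) ω) ^ 2 ≤ (U + U) ^ 2 := by
    rw [← sq_abs]
    exact pow_le_pow_left₀ (abs_nonneg _) ((abs_sub _ _).trans (add_le_add h1 h2)) 2
  nlinarith [sq_nonneg ((F ω - (μ[y | m]) ω) - ((μ[y | m]) ω - t ω))]

end Transfer

/-! ### Irrelevance of the temperature under a constant prior. -/

section UniformPrior

variable {𝒳 : Type*} {M n : ℕ}

/-- With a constant prior the temperature is irrelevant. -/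
theorem IsQAggregate.of_const_prior {ν b c : ℝ} {label : Obs 𝒳 → ℝ} {f : Fin M → 𝒳 → ℝ}
    {s : Fin n → Obs 𝒳} {θ : Fin M → ℝ} (h : IsQAggregate ν b (fun _ => c) label f s θ) (b' : ℝ) :
    IsQAggregate ν b' (fun _ => c) label f s θ := by
  have e : ∀ b, ∀ θ ∈ stdSimplex ℝ (Fin M), qObjective ν b (fun _ => c) label f s θ =
      (1 / n : ℝ) * ∑ i, qLoss ν label f θ (s i) + b / n * Real.log (1 / c) :=
    fun b θ hθ => by rw [qObjective, ← Finset.sum_mul, hθ.2, one_mul]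
  refine ⟨h.1, fun θ' hθ' => ?_⟩
  have h2 := h.2 hθ'
  simp only [Set.mem_ofPred_eq, e b θ' hθ', e b θ h.1] at h2
  simp only [Set.mem_ofPred_eq, e b' θ' hθ', e b' θ h.1]
  linarith

end UniformPrior

/-! ### Mixed bias and the oracle inequality for the pseudo-outcome. -/

namespace IVTrial

variable {Ω 𝒳 : Type*} {T : IVTrial Ω 𝒳}

section Distances

variable [MeasurableSpace Ω] {μ : Measure Ω}

theorem sqDist_eq_ofReal_integral {f τ₀ : 𝒳 → ℝ}
    (h : Integrable (fun ω => (f (T.X ω) - τ₀ (T.X ω)) ^ 2) μ) :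
    T.sqDist μ f τ₀ = ENNReal.ofReal (∫ ω, (f (T.X ω) - τ₀ (T.X ω)) ^ 2 ∂μ) :=
  (ofReal_integral_eq_lintegral_ofReal h
    (Filter.Eventually.of_forall fun _ => sq_nonneg _)).symm

/-- The bias of the pseudo-outcome with nuisance estimates `τh` and `βh`. -/
def bias (T : IVTrial Ω 𝒳) (τ₀ β₀ τh βh : 𝒳 → ℝ) (ω : Ω) : ℝ :=
  (τ₀ (T.X ω) - τh (T.X ω)) * ((β₀ (T.X ω) - βh (T.X ω)) / βh (T.X ω))

theorem errorSq_eq (τ₀ β₀ τh βh : 𝒳 → ℝ) :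
    T.errorSq μ τ₀ β₀ τh βh =
      4 * ∫⁻ ω, ENNReal.ofReal (T.bias τ₀ β₀ τh βh ω ^ 2) ∂μ := by
  simp only [errorSq, bias, mul_pow, div_pow]

theorem sqDist_congr {f g τ₀ : 𝒳 → ℝ} (h : ∀ᵐ ω ∂μ, f (T.X ω) = g (T.X ω)) :
    T.sqDist μ f τ₀ = T.sqDist μ g τ₀ :=
  lintegral_congr_ae (h.mono fun ω hω => by simp only [hω])

/-- If all candidates vanish, so do all ensembles. -/
theorem sqDist_ensemble_eq_of_nonpos {U : ℝ} (hU : U ≤ 0) {M : ℕ} {f : Fin M → 𝒳 → ℝ}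
    (hf : ∀ j, ∀ᵐ ω ∂μ, |f j (T.X ω)| ≤ U) (θ : Fin M → ℝ) (τ₀ : 𝒳 → ℝ) (j : Fin M) :
    T.sqDist μ (ensemble f θ) τ₀ = T.sqDist μ (f j) τ₀ := by
  refine sqDist_congr ((ae_all_iff.2 hf).mono fun ω hω => ?_)
  have h0 : ∀ k, f k (T.X ω) = 0 := fun k => abs_nonpos_iff.1 ((hω k).trans hU)
  simp [ensemble, h0]

end Distances

variable [MeasurableSpace 𝒳] [MeasurableSpace Ω] [StandardBorelSpace Ω] {μ : Measure Ω} [IsProbabilityMeasure μ]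
  {π₀ : 𝒳 → ℝ}

theorem measurable_pseudoOutcome {τ β : 𝒳 → ℝ} (hπ : Measurable π₀) (hτ : Measurable τ)
    (hβ : Measurable β) : Measurable (pseudoOutcome π₀ τ β) := by
  have h : Measurable fun o : Obs 𝒳 => τ o.1 + (o.2.2.2 - τ o.1 * ind o.2.2.1) *
      (ind o.2.1 - π₀ o.1) / β o.1 := by
    have m1 : Measurable fun o : Obs 𝒳 => ind o.2.2.1 :=
      measurable_ind.comp measurable_snd.snd.fst
    have m2 : Measurable fun o : Obs 𝒳 => ind o.2.1 := measurable_ind.comp measurable_snd.fst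
    fun_prop
  exact h

/-- The mixed bias property. -/
theorem IsStratified.condExp_pseudoOutcome_sub (h : T.IsStratified μ π₀) {τ₀ β₀ τh βh : 𝒳 → ℝ}
    (hτ₀ : T.IsCLATE μ τ₀) (hβ₀ : T.IsCompliance μ π₀ β₀) (mτ : Measurable τh)
    (mβ : Measurable βh) (hβ : ∀ᵐ ω ∂μ, βh (T.X ω) ≠ 0)
    (hint : Integrable (fun ω => pseudoOutcome π₀ τh βh (T.obs ω)) μ) :
    (fun ω => (μ[fun ω' => pseudoOutcome π₀ τh βh (T.obs ω') | T.sigmaX]) ω - τ₀ (T.X ω))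
      =ᵐ[μ] T.bias τ₀ β₀ τh βh := by
  filter_upwards [h.condExp_pseudoOutcome hτ₀ hβ₀ mτ mβ hint, hβ] with ω h1 h2
  rw [h1, bias]
  field_simp
  ring

/-- At the true nuisances the correction term vanishes, so the oracle pseudo-outcome has conditional
mean `τ₀` whatever the value of `β₀/β₀`. -/
theorem IsStratified.condExp_pseudoOutcome_sub_oracle (h : T.IsStratified μ π₀)
    {τ₀ β₀ τh βh : 𝒳 → ℝ} (hτ₀ : T.IsCLATE μ τ₀) (hβ₀ : T.IsCompliance μ π₀ β₀)
    (mτ : Measurable τh) (mβ : Measurable βh) (hβ : ∀ᵐ ω ∂μ, βh (T.X ω) ≠ 0)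
    (hint : Integrable (fun ω => pseudoOutcome π₀ τh βh (T.obs ω)) μ)
    (hint₀ : Integrable (fun ω => pseudoOutcome π₀ τ₀ β₀ (T.obs ω)) μ) :
    μ[fun ω => pseudoOutcome π₀ τh βh (T.obs ω) - pseudoOutcome π₀ τ₀ β₀ (T.obs ω) | T.sigmaX]
      =ᵐ[μ] T.bias τ₀ β₀ τh βh := by
  filter_upwards [condExp_sub hint hint₀ T.sigmaX,
    h.condExp_pseudoOutcome hτ₀ hβ₀ hτ₀.measurable hβ₀.measurable hint₀,
    h.condExp_pseudoOutcome_sub hτ₀ hβ₀ mτ mβ hβ hint] with ω h1 h2 h3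
  refine h1.trans ?_
  rw [Pi.sub_apply, h2, sub_self, zero_mul, add_zero, h3]

/-- Oracle inequality for Q-aggregation with the doubly robust pseudo-outcome as label. -/
theorem IsStratified.measure_exists_isQAggregate_le (h : T.IsStratified μ π₀)
    {τ₀ β₀ τh βh : 𝒳 → ℝ} (hτ₀ : T.IsCLATE μ τ₀) (hβ₀ : T.IsCompliance μ π₀ β₀)
    (mτ : Measurable τh) (mβ : Measurable βh) (hβ : ∀ᵐ ω ∂μ, βh (T.X ω) ≠ 0) {U : ℝ}
    (hU : 0 < U) (hlabel : ∀ᵐ ω ∂μ, |pseudoOutcome π₀ τh βh (T.obs ω)| ≤ U) {M : ℕ} (hM : 1 ≤ M)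
    {f : Fin M → 𝒳 → ℝ} (mf : ∀ j, Measurable (f j)) (hf : ∀ j, ∀ᵐ ω ∂μ, |f j (T.X ω)| ≤ U)
    {n : ℕ} (hn : 1 ≤ n) {δ : ℝ} (hδ : 0 < δ) (hδ1 : δ < 1) {b : ℝ} (hb : 112 * U ^ 2 ≤ b)
    {p : Fin M → ℝ} (hp : ∀ j, 0 < p j) (hp1 : ∑ j, p j = 1) :
    T.sampleLaw μ n {s | ∃ θ : Fin M → ℝ,
        IsQAggregate (1 / 2) b p (pseudoOutcome π₀ τh βh) f s θ ∧
        ¬ (T.sqDist μ (ensemble f θ) τ₀ ≤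
          (⨅ j, (T.sqDist μ (f j) τ₀ + ENNReal.ofReal (b / n * Real.log (1 / p j)))) +
            (ENNReal.ofReal (56 * U ^ 2 * (Real.log (1 / δ) / n)) +
              ENNReal.ofReal 7 * T.errorSq μ τ₀ β₀ τh βh))} ≤ ENNReal.ofReal δ := by
  have mlabel := measurable_pseudoOutcome h.measurable_propensity mτ mβ
  have mobs := h.measurable_obs
  have : IsProbabilityMeasure (μ.map T.obs) := Measure.isProbabilityMeasure_map mobs.aemeasurable
  have : NeZero M := ⟨by omega⟩
  have hint : Integrable (fun ω => pseudoOutcome π₀ τh βh (T.obs ω)) μ :=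
    integrable_of_abs_le (mlabel.comp mobs) U hlabel
  have mB : Measurable (T.bias τ₀ β₀ τh βh) := by
    have h1 : Measurable fun x => (τ₀ x - τh x) * ((β₀ x - βh x) / βh x) :=
      (hτ₀.measurable.sub mτ).mul ((hβ₀.measurable.sub mβ).div mβ)
    exact h1.comp h.measurable_X
  -- An infinite error makes the bound vacuous; otherwise the bias is square integrable.
  by_cases hE : T.errorSq μ τ₀ β₀ τh βh = ∞
  · refine (measure_mono (t := ∅) ?_).trans (by simp)
    rintro s ⟨θ, -, hlt⟩
    refine hlt ?_
    rw [hE, ENNReal.mul_top (by simp), add_top, add_top]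
    exact le_top
  have hB : Integrable (fun ω => T.bias τ₀ β₀ τh βh ω ^ 2) μ := by
    refine ⟨(mB.pow_const 2).aestronglyMeasurable, ?_⟩
    rw [hasFiniteIntegral_iff_ofReal (Filter.Eventually.of_forall fun _ => sq_nonneg _)]
    rw [errorSq_eq] at hE
    exact lt_top_iff_ne_top.2 fun h0 => hE (by rw [h0]; exact ENNReal.mul_top (by norm_num))
  have hEeq : T.errorSq μ τ₀ β₀ τh βh =
      ENNReal.ofReal (4 * ∫ ω, T.bias τ₀ β₀ τh βh ω ^ 2 ∂μ) := by
    rw [errorSq_eq, ENNReal.ofReal_mul (by norm_num),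
      ofReal_integral_eq_lintegral_ofReal hB (Filter.Eventually.of_forall fun _ => sq_nonneg _)]
    norm_num
  have hbias := h.condExp_pseudoOutcome_sub hτ₀ hβ₀ mτ mβ hβ hint
  -- The best competitor does not depend on the sample, so the inequality for this single `j`
  -- suffices and no union bound over competitors is needed.
  obtain ⟨j, hj⟩ := Finite.exists_min fun j =>
    T.sqDist μ (f j) τ₀ + ENNReal.ofReal (b / n * Real.log (1 / p j))
  have hmap : ∀ g : Obs 𝒳 → ℝ, Measurable g → (∀ᵐ ω ∂μ, |g (T.obs ω)| ≤ U) →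
      ∀ᵐ o ∂(μ.map T.obs), |g o| ≤ U := fun g mg hg =>
    (ae_map_iff mobs.aemeasurable (measurableSet_le (by fun_prop) measurable_const)).2 hg
  have key := _root_.measure_exists_isQAggregate_le (P := μ.map T.obs) hU mlabel
    (hmap _ mlabel hlabel) mf (fun j => hmap _ ((mf j).comp measurable_fst) (hf j)) hn hδ hb hp
    hp1 j
  refine (measure_mono ?_).trans key
  rintro s ⟨θ, hθ, hlt⟩
  refine ⟨θ, hθ, fun hle => hlt ?_⟩
  have mθ := measurable_ensemble mf θ
  have hθU : ∀ᵐ ω ∂μ, |ensemble f θ (T.X ω)| ≤ U :=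
    (ae_all_iff.2 hf).mono fun ω hω => abs_ensemble_le hθ.1 hω
  have mj := mf j
  rw [integral_map mobs.aemeasurable (Measurable.aestronglyMeasurable (by fun_prop))] at hle
  have iF := integrable_sq_sub_target hlabel (mθ.comp h.measurable_X) hθU
    (hτ₀.measurable.comp h.measurable_X) hbias hB
  have iG := integrable_sq_sub_target hlabel (mj.comp h.measurable_X) (hf j)
    (hτ₀.measurable.comp h.measurable_X) hbias hB
  have htrans := integral_sq_sub_target_le h.measurable_X.comap_le (mlabel.comp mobs) hlabel
    (mθ.comp (comap_measurable T.X)) hθU (mj.comp (comap_measurable T.X)) (hf j) hbias hB iF iG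
  have hinf : (⨅ j, (T.sqDist μ (f j) τ₀ + ENNReal.ofReal (b / n * Real.log (1 / p j)))) =
      T.sqDist μ (f j) τ₀ + ENNReal.ofReal (b / n * Real.log (1 / p j)) :=
    le_antisymm (iInf_le _ j) (le_iInf hj)
  have hb0 : 0 ≤ b := le_trans (by positivity) hb
  have hlogp : 0 ≤ Real.log (1 / p j) := Real.log_nonneg (one_le_one_div (hp j)
    (hp1 ▸ Finset.single_le_sum (fun i _ => (hp i).le) (Finset.mem_univ j)))
  have hlogδ : 0 ≤ Real.log (1 / δ) := Real.log_nonneg (one_le_one_div hδ hδ1.le)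
  have hB0 : 0 ≤ ∫ ω, T.bias τ₀ β₀ τh βh ω ^ 2 ∂μ := integral_nonneg fun _ => sq_nonneg _
  have hG0 : 0 ≤ ∫ ω, (f j (T.X ω) - τ₀ (T.X ω)) ^ 2 ∂μ := integral_nonneg fun _ => sq_nonneg _
  have hp0 : 0 ≤ b / n * Real.log (1 / p j) := by positivity
  have hδ0 : 0 ≤ 56 * U ^ 2 * (Real.log (1 / δ) / n) := by positivity
  rw [hinf, hEeq, sqDist_eq_ofReal_integral iF, sqDist_eq_ofReal_integral iG,
    ← ENNReal.ofReal_mul (by norm_num), ← ENNReal.ofReal_add hG0 hp0,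
    ← ENNReal.ofReal_add hδ0 (by positivity), ← ENNReal.ofReal_add (by positivity) (by positivity)]
  -- The coefficient `25` of `E[bias²]` fits under `7 · 4`, since the error carries a factor `4`.
  refine ENNReal.ofReal_le_ofReal (htrans.trans ?_)
  refine (add_le_add_left (add_le_add_right hle _) _).trans ?_
  simp only [Function.comp_apply]
  linarith

end IVTrial

end

/-! ### Choice of the constant and the two priors. -/

theorem mainTheorem8 (U : ℝ) :
    ∃ C : ℝ, 0 < C ∧
      ∀ (Ω : Type*) [MeasurableSpace Ω] [StandardBorelSpace Ω] (𝒳 : Type*) [MeasurableSpace 𝒳]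
        (μ : Measure Ω) [IsProbabilityMeasure μ] (T : IVTrial Ω 𝒳) (π₀ τ₀ β₀ : 𝒳 → ℝ)
        (_ : T.IsStratified μ π₀) (_ : T.IsCLATE μ τ₀) (_ : T.IsCompliance μ π₀ β₀)
        (αh βh τh : 𝒳 → ℝ) (_ : Measurable αh) (_ : Measurable βh)
        (_ : ∀ᵐ ω ∂μ, βh (T.X ω) ≠ 0) (_ : ∀ x, τh x = αh x / βh x)
        (_ : ∀ᵐ ω ∂μ, |pseudoOutcome π₀ τh βh (T.obs ω)| ≤ U),
        -- the mixed bias property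
        ((fun ω => (μ[fun ω' => pseudoOutcome π₀ τh βh (T.obs ω') | T.sigmaX]) ω - τ₀ (T.X ω))
          =ᵐ[μ] fun ω => (τ₀ (T.X ω) - τh (T.X ω)) *
            ((β₀ (T.X ω) - βh (T.X ω)) / βh (T.X ω))) ∧
        (Integrable (fun ω => pseudoOutcome π₀ τ₀ β₀ (T.obs ω)) μ →
          μ[fun ω => pseudoOutcome π₀ τh βh (T.obs ω) - pseudoOutcome π₀ τ₀ β₀ (T.obs ω)
              | T.sigmaX]
            =ᵐ[μ] fun ω => (τ₀ (T.X ω) - τh (T.X ω)) *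
              ((β₀ (T.X ω) - βh (T.X ω)) / βh (T.X ω))) ∧
        -- the oracle inequalities
        ∀ (M : ℕ) (_ : 1 ≤ M) (f : Fin M → 𝒳 → ℝ) (_ : ∀ j, Measurable (f j))
          (_ : ∀ j, ∀ᵐ ω ∂μ, |f j (T.X ω)| ≤ U)
          (n : ℕ) (_ : 1 ≤ n) (δ : ℝ) (_ : 0 < δ) (_ : δ < 1) (b : ℝ),
          -- uniform prior, at any temperature
          (T.sampleLaw μ n {s | ∃ θ : Fin M → ℝ,
              IsQAggregate (1 / 2) b (fun _ => 1 / (M : ℝ)) (pseudoOutcome π₀ τh βh) f s θ ∧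
              ¬ (T.sqDist μ (ensemble f θ) τ₀ ≤
                  (⨅ j, T.sqDist μ (f j) τ₀) +
                  ENNReal.ofReal C *
                    (ENNReal.ofReal ((Real.log M + Real.log (1 / δ)) / n) +
                      T.errorSq μ τ₀ β₀ τh βh))} ≤ ENNReal.ofReal δ) ∧
          -- arbitrary prior
          (max (112 * U ^ 2) (56 * U ^ 3) ≤ b →
            ∀ p : Fin M → ℝ, (∀ j, 0 < p j) → ∑ j, p j = 1 →
              T.sampleLaw μ n {s | ∃ θ : Fin M → ℝ,
                IsQAggregate (1 / 2) b p (pseudoOutcome π₀ τh βh) f s θ ∧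
                ¬ (T.sqDist μ (ensemble f θ) τ₀ ≤
                    (⨅ j, (T.sqDist μ (f j) τ₀ +
                      ENNReal.ofReal (b / n * Real.log (1 / p j)))) +
                    ENNReal.ofReal C *
                      (ENNReal.ofReal (Real.log (1 / δ) / n) +
                        T.errorSq μ τ₀ β₀ τh βh))} ≤ ENNReal.ofReal δ) := by
  -- `112U²` covers both the uniform-prior cost of `log M` and the deviation constant `56U²`; `7`
  -- covers the bias, and keeps the constant positive when `U = 0`.
  refine ⟨112 * U ^ 2 + 7, by positivity, ?_⟩
  intro Ω _ _ 𝒳 _ μ _ T π₀ τ₀ β₀ h hτ₀ hβ₀ αh βh τh mα mβ hβ hτh hlabel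
  have mτ : Measurable τh := by
    rw [funext hτh]
    exact mα.div mβ
  have hint : Integrable (fun ω => pseudoOutcome π₀ τh βh (T.obs ω)) μ :=
    integrable_of_abs_le ((IVTrial.measurable_pseudoOutcome h.measurable_propensity mτ mβ).comp
      h.measurable_obs) U hlabel
  refine ⟨h.condExp_pseudoOutcome_sub hτ₀ hβ₀ mτ mβ hβ hint,
    h.condExp_pseudoOutcome_sub_oracle hτ₀ hβ₀ mτ mβ hβ hint, ?_⟩
  intro M hM f mf hf n hn δ hδ hδ1 b
  have hM' : (1 : ℝ) ≤ M := by exact_mod_cast hM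
  have hn' : (0 : ℝ) < n := by exact_mod_cast hn
  have hlogM : 0 ≤ Real.log M := Real.log_nonneg hM'
  have hlogδ : 0 ≤ Real.log (1 / δ) := Real.log_nonneg (one_le_one_div hδ hδ1.le)
  have hC7 : ENNReal.ofReal 7 ≤ ENNReal.ofReal (112 * U ^ 2 + 7) :=
    ENNReal.ofReal_le_ofReal (by linarith [sq_nonneg U])
  -- For `U ≤ 0` the scaling by `U²` is not available, but all candidates vanish almost surely and
  -- every ensemble is equally far from the target.
  rcases le_or_gt U 0 with hU | hU
  · have h0 := fun θ => IVTrial.sqDist_ensemble_eq_of_nonpos (τ₀ := τ₀) hU hf θ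
    constructor
    · refine (measure_mono (t := ∅) ?_).trans (by simp)
      rintro s ⟨θ, -, hlt⟩
      exact hlt (le_add_right (le_iInf fun j => (h0 θ j).le))
    · intro hb p hp hp1
      refine (measure_mono (t := ∅) ?_).trans (by simp)
      rintro s ⟨θ, -, hlt⟩
      exact hlt (le_add_right (le_iInf fun j => le_add_right (h0 θ j).le))
  · constructor
    -- The general bound is used at the smallest admissible temperature `112U²`, whatever the given
    -- `b`, because a constant prior leaves the set of minimizers unchanged.
    · refine (measure_mono ?_).trans (h.measure_exists_isQAggregate_le hτ₀ hβ₀ mτ mβ hβ hU hlabel hM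
        mf hf hn hδ hδ1 le_rfl (p := fun _ => 1 / (M : ℝ)) (fun _ => by positivity)
        (by simp; field_simp))
      rintro s ⟨θ, hθ, hlt⟩
      refine ⟨θ, hθ.of_const_prior _, fun hle => hlt (hle.trans ?_)⟩
      rw [one_div_one_div, ← ENNReal.iInf_add, add_assoc, ← add_assoc (ENNReal.ofReal _), mul_add,
        ← ENNReal.ofReal_mul (by positivity), ← ENNReal.ofReal_add (by positivity) (by positivity)]
      refine add_le_add le_rfl (add_le_add (ENNReal.ofReal_le_ofReal ?_)
        (mul_le_mul_left hC7 _))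
      have h1 : 0 ≤ Real.log M / n := by positivity
      have h2 : 0 ≤ Real.log (1 / δ) / n := by positivity
      rw [add_div, div_mul_eq_mul_div, mul_div_assoc]
      nlinarith [mul_nonneg (sq_nonneg U) h2]
    · intro hb p hp hp1
      refine (measure_mono ?_).trans (h.measure_exists_isQAggregate_le hτ₀ hβ₀ mτ mβ hβ hU hlabel hM
        mf hf hn hδ hδ1 ((le_max_left _ _).trans hb) hp hp1)
      rintro s ⟨θ, hθ, hlt⟩
      refine ⟨θ, hθ, fun hle => hlt (hle.trans ?_)⟩
      rw [mul_add, ← ENNReal.ofReal_mul (by positivity)]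
      refine add_le_add le_rfl (add_le_add (ENNReal.ofReal_le_ofReal ?_)
        (mul_le_mul_left hC7 _))
      have h2 : 0 ≤ Real.log (1 / δ) / n := by positivity
      nlinarith [mul_nonneg (sq_nonneg U) h2]
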